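/- Let $G$ be a discrete group. For a category $\mathcal{C}$ let $G\mathcal{C}$ be the category of functors $BG\to\mathcal{C}$, where $BG$ is the one-object category with endomorphism group $G$. For complete and cocomplete $\mathcal{C}$ and $H\le G$, the $H$-fixed point functor $(-)^H\colon G\mathcal{C}\to\mathcal{C}$ is $X^H=\lim_{BH}X$. For a $G$-set $S$ and an object $A$ of $\mathcal{C}$, let $S\otimes A=\coprod_S A$ with the $G$-action induced by that on $S$. If $\mathcal{C}$ is a model category, $(-)^H$ is called *cellular* if 1. it preserves directed colimits of diagrams in $G\mathcal{C}$ in which each arrow is a cofibration in $\mathcal{C}$ after forgetting the action; 2. it preserves pushouts of diagrams in which one leg is $G/K\otimes f\colon G/K\otimes A\to G/K\otimes B$ for a subgroup $K\le G$ and a cofibration $f\colon A\to B$ in $\mathcal{C}$; 3. for every subgroup $K\le G$ and every object $A$ of $\mathcal{C}$ the induced map $(G/K)^H\otimes A\to(G/K\otimes A)^H$ is an isomorphism. Let $\mathscr{O}_G$ be the orbit category of $G$ (objects $G/H$ for $H\le G$, morphisms all equivariant maps), and let $\Phi\colon G\mathcal{C}\to\mathrm{Fun}(\mathscr{O}_G^{op},\mathcal{C})$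 be the functor $\Phi(X)(G/H)=X^H$. A model structure on $G\mathcal{C}$ is a *fixed point model structure* if a map $f$ is a fibration (resp. weak equivalence) if and only if $\Phi(f)$ is a fibration (resp. weak equivalence) in the projective model structure, i.e. levelwise in $\mathcal{C}$. (Such a structure is unique if it exists.) **Theorem.** Let $\mathcal{C}$ and $\mathcal{D}$ be (complete and cocomplete, locally small) cofibrantly generated model categories such that for every subgroup $H\le G$ the functors $(-)^H\colon G\mathcal{C}\to\mathcal{C}$ and $(-)^H\colon G\mathcal{D}\to\mathcal{D}$ are cellular. Let $L\colon\mathcal{C}\rightleftarrows\mathcal{D}:\!R$ be a Quillen adjunction, and let $L_*\colon G\mathcal{C}\rightleftarrows G\mathcal{D}:\!R_*$ be the adjunction given by composition with $L$ and $R$. Then $G\mathcal{C}$ and $G\mathcal{D}$ have fixed point model structures, and with respect to these $L_*\dashv R_*$ is a Quillen adjunction. If moreover $L\dashv R$ is a Quillen equivalence, then $L_*\dashv R_*$ is a Quillen equivalence. -/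

import Mathlib

open CategoryTheory Limits HomotopicalAlgebra

universe v u u₁ u₂

namespace FixedPointModel

noncomputable section

/-! ### Cofibrantly generated model categories and Quillen adjunctions -/

/-- A model category is cofibrantly generated if there are (small) sets `I` and `J` of maps, both
permitting the small object argument, such that the fibrations are the maps with the right lifting
property with respect to `J` and the trivial fibrations are the maps with the right lifting
property with respect to `I`. -/
class IsCofibrantlyGenerated (C : Type u) [Category.{v} C] [ModelCategory C] : Prop where
  exists_generators : ∃ I J : MorphismProperty C,
    MorphismProperty.HasSmallObjectArgument.{v} I ∧
    MorphismProperty.HasSmallObjectArgument.{v} J ∧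
    trivialFibrations C = I.rlp ∧ fibrations C = J.rlp

/-- An adjunction between model categories is a Quillen adjunction if the left adjoint preserves
cofibrations and trivial cofibrations. -/
structure IsQuillenAdjunction {C : Type u₁} [Category.{v} C] [ModelCategory C]
    {D : Type u₂} [Category.{v} D] [ModelCategory D] {L : C ⥤ D} {R : D ⥤ C}
    (_adj : L ⊣ R) : Prop where
  cofibrations_map ⦃A B : C⦄ (f : A ⟶ B) : cofibrations C f → cofibrations D (L.map f)
  trivialCofibrations_map ⦃A B : C⦄ (f : A ⟶ B) :
    trivialCofibrations C f → trivialCofibrations D (L.map f)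

/-- A Quillen adjunction is a Quillen equivalence if, for `X` cofibrant and `Y` fibrant, a map
`L X ⟶ Y` is a weak equivalence if and only if its adjunct `X ⟶ R Y` is. -/
structure IsQuillenEquivalence {C : Type u₁} [Category.{v} C] [ModelCategory C]
    {D : Type u₂} [Category.{v} D] [ModelCategory D] {L : C ⥤ D} {R : D ⥤ C}
    (adj : L ⊣ R) : Prop extends IsQuillenAdjunction adj where
  weakEquivalences_iff (X : C) (Y : D) (_ : IsCofibrant X) (_ : IsFibrant Y) (f : L.obj X ⟶ Y) :
    weakEquivalences D f ↔ weakEquivalences C (adj.homEquiv X Y f)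

/-! ### Objects with a group action and fixed points -/

/-- The category of `G`-objects of `C`: functors from the one-object category of `G` to `C`. -/
abbrev GObj (G : Type v) [Group G] (C : Type u) [Category.{v} C] : Type _ := SingleObj G ⥤ C

instance hasLimitsOfShape_singleObj (C : Type u) [Category.{v} C] [HasLimits C]
    (H : Type v) [Group H] : HasLimitsOfShape (SingleObj H) C :=
  hasLimitsOfShape_of_essentiallySmall.{v} (SingleObj H) C

section

variable {G : Type v} [Group G]

/-- The inclusion of the one-object category of a subgroup. -/
abbrev subgroupIncl (H : Subgroup G) : SingleObj H ⥤ SingleObj G :=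
  SingleObj.mapHom H G H.subtype

variable (C : Type u) [Category.{v} C]

/-- The forgetful functor from `G`-objects to objects. -/
abbrev forgetAction (G : Type v) [Group G] (C : Type u) [Category.{v} C] : GObj G C ⥤ C :=
  (evaluation (SingleObj G) C).obj (SingleObj.star G)

/-- The `H`-fixed point functor: the limit of the restriction of the action to `H`. -/
def fixedPointFunctor [HasLimits C] (H : Subgroup G) : GObj G C ⥤ C :=
  (Functor.whiskeringLeft _ _ C).obj (subgroupIncl H) ⋙ lim

variable {C}

/-- The canonical map from the `H`-fixed points of `X` to `X`. -/
def fixedPointsι [HasLimits C] (H : Subgroup G) (X : GObj G C) :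
    (fixedPointFunctor C H).obj X ⟶ X.obj (SingleObj.star G) :=
  limit.π (subgroupIncl H ⋙ X) (SingleObj.star H)

lemma fixedPointsι_map [HasLimits C] (H : Subgroup G) (X : GObj G C) (h : G) (hh : h ∈ H) :
    fixedPointsι H X ≫ X.map (X := SingleObj.star G) (Y := SingleObj.star G) h =
      fixedPointsι H X :=
  limit.w (subgroupIncl H ⋙ X) (j := SingleObj.star H) (j' := SingleObj.star H) ⟨h, hh⟩

lemma fixedPointFunctor_map_ι [HasLimits C] (H : Subgroup G) {X Y : GObj G C} (f : X ⟶ Y) :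
    (fixedPointFunctor C H).map f ≫ fixedPointsι H Y =
      fixedPointsι H X ≫ f.app (SingleObj.star G) :=
  limMap_π (Functor.whiskerLeft (subgroupIncl H) f) (SingleObj.star H)

/-- Maps into the fixed points are maps that are invariant under the action of `H`. -/
def fixedPointsLift [HasLimits C] (H : Subgroup G) (X : GObj G C) {A : C}
    (f : A ⟶ X.obj (SingleObj.star G))
    (hf : ∀ h ∈ H, f ≫ X.map (X := SingleObj.star G) (Y := SingleObj.star G) h = f) :
    A ⟶ (fixedPointFunctor C H).obj X :=
  limit.lift (subgroupIncl H ⋙ X)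
    { pt := A
      π :=
        { app := fun _ => f
          naturality := fun _ _ h => by
            have := hf h.1 h.2
            exact (Category.id_comp f).trans this.symm } }

@[simp]
lemma fixedPointsLift_ι [HasLimits C] (H : Subgroup G) (X : GObj G C) {A : C}
    (f : A ⟶ X.obj (SingleObj.star G))
    (hf : ∀ h ∈ H, f ≫ X.map (X := SingleObj.star G) (Y := SingleObj.star G) h = f) :
    fixedPointsLift H X f hf ≫ fixedPointsι H X = f :=
  limit.lift_π _ _

lemma fixedPoints_hom_ext [HasLimits C] (H : Subgroup G) (X : GObj G C) {A : C}
    {f g : A ⟶ (fixedPointFunctor C H).obj X}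
    (hfg : f ≫ fixedPointsι H X = g ≫ fixedPointsι H X) : f = g :=
  limit.hom_ext fun _ => hfg

/-! ### Tensors with `G`-sets and cellular fixed point functors -/

/-- The tensor `S ⊗ A` of a `G`-set and an object: the coproduct of copies of `A` indexed by `S`,
with `g` sending the summand of `s` identically to the summand of `g • s`. -/
def tensor [HasColimits C] (S : Type v) [MulAction G S] (A : C) : GObj G C where
  obj _ := ∐ fun _ : S => A
  map (g : G) := Sigma.desc fun s : S => Sigma.ι (fun _ : S => A) (g • s)
  map_id _ := by
    refine Sigma.hom_ext _ _ fun s => ?_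
    rw [Sigma.ι_desc, SingleObj.id_as_one, one_smul, Category.comp_id]
  map_comp f g := by
    refine Sigma.hom_ext _ _ fun s => ?_
    rw [Sigma.ι_desc, Sigma.ι_desc_assoc, Sigma.ι_desc, SingleObj.comp_as_mul, mul_smul]

/-- The map `S ⊗ f : S ⊗ A ⟶ S ⊗ B`. -/
def tensorMap [HasColimits C] (S : Type v) [MulAction G S] {A B : C} (f : A ⟶ B) :
    tensor (G := G) S A ⟶ tensor (G := G) S B where
  app _ := Limits.Sigma.map fun _ : S => f
  naturality _ _ (g : G) := by
    refine Sigma.hom_ext _ _ fun s => ?_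
    dsimp only [tensor]
    rw [Sigma.ι_desc_assoc, Sigma.ι_map, Sigma.ι_map_assoc, Sigma.ι_desc]

/-- The canonical map `S^H ⊗ A ⟶ (S ⊗ A)^H`, induced by the inclusions of the summands indexed
by the `H`-fixed elements. -/
def tensorFixedPoints [HasLimits C] [HasColimits C] (H : Subgroup G) (S : Type v)
    [MulAction G S] (A : C) :
    (∐ fun _ : MulAction.fixedPoints H S => A) ⟶
      (fixedPointFunctor C H).obj (tensor (G := G) S A) :=
  Sigma.desc fun s => fixedPointsLift H _ (Sigma.ι (fun _ : S => A) s.1) fun h hh => by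
    have hs : h • s.1 = s.1 := s.2 ⟨h, hh⟩
    change Sigma.ι (fun _ : S => A) s.1 ≫
      (Sigma.desc fun s : S => Sigma.ι (fun _ : S => A) (h • s)) = _
    rw [Sigma.ι_desc, hs]

variable (C)

/-- The `H`-fixed point functor on `G`-objects of a model category is cellular. -/
structure IsCellular [HasLimits C] [HasColimits C] [ModelCategory C] (H : Subgroup G) :
    Prop where
  /-- It preserves directed colimits of diagrams of underlying cofibrations. -/
  preserves_directed (P : Type v) [PartialOrder P] [IsDirectedOrder P] [Nonempty P]
    (F : P ⥤ GObj G C)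
    (_ : ∀ ⦃i j : P⦄ (φ : i ⟶ j), cofibrations C ((forgetAction G C).map (F.map φ))) :
    PreservesColimit F (fixedPointFunctor C H)
  /-- It preserves pushouts along `G/K ⊗ f` for `f` a cofibration. -/
  preserves_pushouts (K : Subgroup G) {A B : C} (f : A ⟶ B) (_ : cofibrations C f)
    (X : GObj G C) (g : tensor (G := G) (G ⧸ K) A ⟶ X) :
    PreservesColimit (span (tensorMap (G := G) (G ⧸ K) f) g) (fixedPointFunctor C H)
  /-- The canonical map `(G/K)^H ⊗ A ⟶ (G/K ⊗ A)^H` is an isomorphism. -/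
  isIso_tensorFixedPoints (K : Subgroup G) (A : C) :
    IsIso (tensorFixedPoints (G := G) H (G ⧸ K) A)

end

/-! ### The orbit category and the functor `Φ` -/

/-- The orbit category of `G`: its objects are the orbits `G/H` for the subgroups `H` of `G`, and
its morphisms are all `G`-equivariant maps. -/
structure OrbitCategory (G : Type v) [Group G] : Type v where
  /-- the subgroup `H` of the orbit `G/H` -/
  stab : Subgroup G

instance (G : Type v) [Group G] : Category.{v} (OrbitCategory G) where
  Hom H K := (G ⧸ H.stab) →[G] (G ⧸ K.stab)
  id _ := MulActionHom.id G
  comp f g := g.comp f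

section

variable {G : Type v} [Group G] {C : Type u} [Category.{v} C] [HasLimits C]

/-- A point `p = gK` of `G/K` determines a map `X^K ⟶ X`: the inclusion followed by the action
of `g`. -/
def evalPoint (X : GObj G C) (K : Subgroup G) (p : G ⧸ K) :
    (fixedPointFunctor C K).obj X ⟶ X.obj (SingleObj.star G) :=
  Quotient.liftOn' p
    (fun g => fixedPointsι K X ≫ X.map (X := SingleObj.star G) (Y := SingleObj.star G) g)
    (fun a b hab => by
      have h := fixedPointsι_map K X _ (QuotientGroup.leftRel_apply.1 hab)
      conv_lhs => rw [← h]
      rw [Category.assoc, ← X.map_comp, SingleObj.comp_as_mul, mul_inv_cancel_left])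

lemma evalPoint_mk (X : GObj G C) (K : Subgroup G) (g : G) :
    evalPoint X K (g : G ⧸ K) =
      fixedPointsι K X ≫ X.map (X := SingleObj.star G) (Y := SingleObj.star G) g :=
  rfl

lemma evalPoint_smul (X : GObj G C) (K : Subgroup G) (g : G) (p : G ⧸ K) :
    evalPoint X K (g • p) =
      evalPoint X K p ≫ X.map (X := SingleObj.star G) (Y := SingleObj.star G) g := by
  induction p using QuotientGroup.induction_on with
  | H a =>
    change evalPoint X K ((g * a : G) : G ⧸ K) = _
    rw [evalPoint_mk, evalPoint_mk, Category.assoc, ← X.map_comp, SingleObj.comp_as_mul]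

lemma evalPoint_naturality {X Y : GObj G C} (f : X ⟶ Y) (K : Subgroup G) (p : G ⧸ K) :
    (fixedPointFunctor C K).map f ≫ evalPoint Y K p =
      evalPoint X K p ≫ f.app (SingleObj.star G) := by
  induction p using QuotientGroup.induction_on with
  | H a =>
    rw [evalPoint_mk, evalPoint_mk, Category.assoc, reassoc_of% fixedPointFunctor_map_ι,
      f.naturality]

/-- An equivariant map `φ : G/H ⟶ G/K` with `φ (eH) = gK` induces the map `X^K ⟶ X^H` given by
the action of `g`. -/
def orbitMap (X : GObj G C) {H K : Subgroup G} (φ : (G ⧸ H) →[G] (G ⧸ K)) :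
    (fixedPointFunctor C K).obj X ⟶ (fixedPointFunctor C H).obj X :=
  fixedPointsLift H X (evalPoint X K (φ ((1 : G) : G ⧸ H))) fun h hh => by
    rw [← evalPoint_smul, ← map_smul φ h]
    congr 2
    change ((h * 1 : G) : G ⧸ H) = ((1 : G) : G ⧸ H)
    rw [mul_one, QuotientGroup.eq]
    simpa using hh

lemma orbitMap_ι (X : GObj G C) {H K : Subgroup G} (φ : (G ⧸ H) →[G] (G ⧸ K)) :
    orbitMap X φ ≫ fixedPointsι H X = evalPoint X K (φ ((1 : G) : G ⧸ H)) :=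
  fixedPointsLift_ι _ _ _ _

lemma orbitMap_naturality {X Y : GObj G C} (f : X ⟶ Y) {H K : Subgroup G}
    (φ : (G ⧸ H) →[G] (G ⧸ K)) :
    orbitMap X φ ≫ (fixedPointFunctor C H).map f =
      (fixedPointFunctor C K).map f ≫ orbitMap Y φ := by
  refine fixedPoints_hom_ext _ _ ?_
  rw [Category.assoc, Category.assoc, fixedPointFunctor_map_ι, orbitMap_ι,
    reassoc_of% orbitMap_ι, evalPoint_naturality]

lemma orbitMap_evalPoint (X : GObj G C) {H K : Subgroup G} (φ : (G ⧸ H) →[G] (G ⧸ K))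
    (p : G ⧸ H) : orbitMap X φ ≫ evalPoint X H p = evalPoint X K (φ p) := by
  induction p using QuotientGroup.induction_on with
  | H a =>
    rw [evalPoint_mk, orbitMap, reassoc_of% fixedPointsLift_ι, ← evalPoint_smul, ← map_smul φ a]
    congr 2
    change ((a * 1 : G) : G ⧸ H) = _
    rw [mul_one]

/-- The functor `Φ`, sending a `G`-object `X` to the diagram `G/H ↦ X^H` on the opposite of the
orbit category. -/
def orbitDiagram (G : Type v) [Group G] (C : Type u) [Category.{v} C] [HasLimits C] :
    GObj G C ⥤ ((OrbitCategory G)ᵒᵖ ⥤ C) where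
  obj X :=
    { obj := fun H => (fixedPointFunctor C H.unop.stab).obj X
      map := fun φ => orbitMap X φ.unop
      map_id := fun H => by
        refine fixedPoints_hom_ext _ _ ?_
        refine (fixedPointsLift_ι _ _ _ _).trans ?_
        change evalPoint X H.unop.stab ((1 : G) : G ⧸ H.unop.stab) = _
        rw [evalPoint_mk, Category.id_comp]
        exact fixedPointsι_map _ _ _ (one_mem _)
      map_comp := fun {H K M} φ ψ => by
        refine fixedPoints_hom_ext _ _ ?_
        rw [Category.assoc]
        refine (fixedPointsLift_ι _ _ _ _).trans ?_
        refine Eq.trans ?_ (congrArg (orbitMap X φ.unop ≫ ·) (fixedPointsLift_ι _ _ _ _).symm)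
        exact (orbitMap_evalPoint X φ.unop _).symm }
  map {X Y} f :=
    { app := fun H => (fixedPointFunctor C H.unop.stab).map f
      naturality := fun _ _ φ =>
        orbitMap_naturality f φ.unop }
  map_id X := by
    ext H
    exact (fixedPointFunctor C H.unop.stab).map_id X
  map_comp f g := by
    ext H
    exact (fixedPointFunctor C H.unop.stab).map_comp f g

/-- A model structure on `G`-objects is the fixed point model structure if its fibrations and weak
equivalences are the maps `f` such that `Φ f` is a fibration, respectively a weak equivalence, in
the projective model structure on diagrams on the opposite of the orbit category, that is, such
that `Φ f` is levelwise a fibration, respectively a weak equivalence. -/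
structure IsFixedPointModelStructure [ModelCategory C] (m : ModelCategory (GObj G C)) :
    Prop where
  fibrations_eq : fibrations (GObj G C) =
    ((fibrations C).functorCategory (OrbitCategory G)ᵒᵖ).inverseImage (orbitDiagram G C)
  weakEquivalences_eq : weakEquivalences (GObj G C) =
    ((weakEquivalences C).functorCategory (OrbitCategory G)ᵒᵖ).inverseImage (orbitDiagram G C)

end

end

end FixedPointModel

/-! The generating (trivial) cofibrations of the fixed point structure are the orbit cells `G/K ⊗
f`, with `f` a generating (trivial) cofibration of `C`. Since `G/K ⊗ -` is left adjoint to `(-)^K`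
(`tensorAdjunction`), lifting against orbit cells is lifting levelwise on fixed points
(`orbitCells_rlp_iff`), so these cells detect the prescribed fibrations and trivial fibrations.

What remains is control of fixed points on cell complexes, which are built by colimits that a limit
functor need not preserve. Cellularity supplies exactly this control. Attaching a family of cells is
a directed colimit, over finite subfamilies, of attachments of one cell at a time, so `(-)^H`
preserves it (`IsCellAttachment.map_of_preserves`). Moreover `(G/K ⊗ A)^H` is a coproduct of copies
of `A`, so the `H`-fixed points of a complex of orbit cells form an ordinary cell complex in `C`
(`relativeCellComplexFixedPoints`). This gives the small object argument for orbit cells, and shows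
that complexes of orbit cells on generating trivial cofibrations are levelwise weak equivalences;
the model structure follows.

The right adjoint `R` preserves limits, hence commutes with fixed points, and `R_*` preserves
fibrations and trivial fibrations. For Quillen equivalences the main point is that `L (X^H) ⟶ (L
X)^H` is an isomorphism for cofibrant `X` (`isIso_fixedPointsComparison_of_isCofibrant`): both sides
are built from the same cells. A map `L_* X ⟶ Y` and its adjunct then correspond, on `H`-fixed
points, to adjunct maps `L (X^H) ⟶ Y^H` and `X^H ⟶ R (Y^H)` with `X^H` cofibrant and `Y^H` fibrant,
so the given equivalence applies for each `H`. -/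

namespace FixedPointModel

universe w v' u'

noncomputable section

/-! ### Cell attachments -/

section CellAttachment

variable {C : Type u} [Category.{v} C]

/-- The object `Y` is obtained from `X` by attaching the cells `f i : A i ⟶ B i` along the maps
`g i : A i ⟶ X`: it is the universal recipient of a map from `X` and of compatible maps from the
objects `B i`. -/
structure IsCellAttachment {ι : Type w} {A B : ι → C} (f : ∀ i, A i ⟶ B i) {X Y : C}
    (g : ∀ i, A i ⟶ X) (y : X ⟶ Y) (b : ∀ i, B i ⟶ Y) : Prop where
  w (i : ι) : f i ≫ b i = g i ≫ y
  exists_desc {Z : C} (u : X ⟶ Z) (v : ∀ i, B i ⟶ Z) (h : ∀ i, f i ≫ v i = g i ≫ u) :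
    ∃ t : Y ⟶ Z, y ≫ t = u ∧ ∀ i, b i ≫ t = v i
  hom_ext {Z : C} {s t : Y ⟶ Z} (h : y ≫ s = y ≫ t) (h' : ∀ i, b i ≫ s = b i ≫ t) : s = t

namespace IsCellAttachment

/-- Together with `isPushout`, this identifies cell attachments with pushouts of coproduct maps. The
formulation without coproducts still makes sense after applying a functor that does not preserve
coproducts, such as a fixed point functor. -/
lemma of_isPushout {ι : Type w} {A B : ι → C} {f : ∀ i, A i ⟶ B i} {X Y : C}
    {c₁ : Cofan A} {c₂ : Cofan B} (h₁ : IsColimit c₁) (h₂ : IsColimit c₂) {m : c₁.pt ⟶ c₂.pt}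
    (hm : ∀ i, c₁.inj i ≫ m = f i ≫ c₂.inj i) {g : c₁.pt ⟶ X} {y : X ⟶ Y} {b : c₂.pt ⟶ Y}
    (sq : IsPushout g m y b) :
    IsCellAttachment f (fun i ↦ c₁.inj i ≫ g) y (fun i ↦ c₂.inj i ≫ b) where
  w i := by rw [← reassoc_of% hm, Category.assoc, sq.w]
  exists_desc {Z} u v h := by
    obtain ⟨t, ht₁, ht₂⟩ := sq.exists_desc u (Cofan.IsColimit.desc h₂ v) (by
      refine Cofan.IsColimit.hom_ext h₁ _ _ fun i ↦ ?_
      rw [reassoc_of% hm, Cofan.IsColimit.fac, h, Category.assoc])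
    exact ⟨t, ht₁, fun i ↦ by rw [Category.assoc, ht₂, Cofan.IsColimit.fac]⟩
  hom_ext h h' := sq.hom_ext h (Cofan.IsColimit.hom_ext h₂ _ _ fun i ↦ by
    simpa only [Category.assoc] using h' i)

lemma isPushout {ι : Type w} {A B : ι → C} {f : ∀ i, A i ⟶ B i} {X Y : C}
    {c₁ : Cofan A} {c₂ : Cofan B} (h₁ : IsColimit c₁) (h₂ : IsColimit c₂) {m : c₁.pt ⟶ c₂.pt}
    (hm : ∀ i, c₁.inj i ≫ m = f i ≫ c₂.inj i) {g : ∀ i, A i ⟶ X} {y : X ⟶ Y}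
    {b : ∀ i, B i ⟶ Y} (h : IsCellAttachment f g y b) :
    IsPushout (Cofan.IsColimit.desc h₁ g) m y (Cofan.IsColimit.desc h₂ b) where
  w := Cofan.IsColimit.hom_ext h₁ _ _ fun i ↦ by
    rw [reassoc_of% hm, Cofan.IsColimit.fac, Cofan.IsColimit.fac_assoc, h.w]
  isColimit' := ⟨by
    have key (s : PushoutCocone (Cofan.IsColimit.desc h₁ g) m) :=
      h.exists_desc s.inl (fun i ↦ c₂.inj i ≫ s.inr) (fun i ↦ by
        rw [← reassoc_of% hm, ← s.condition, Cofan.IsColimit.fac_assoc])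
    choose t ht₁ ht₂ using key
    refine PushoutCocone.IsColimit.mk _ t ht₁ (fun s ↦ ?_) (fun s t' h₁' h₂' ↦ ?_)
    · refine Cofan.IsColimit.hom_ext h₂ _ _ fun i ↦ ?_
      rw [Cofan.IsColimit.fac_assoc, ht₂]
    · refine h.hom_ext (h₁'.trans (ht₁ s).symm) fun i ↦ ?_
      rw [ht₂, ← h₂', Cofan.IsColimit.fac_assoc]⟩

lemma exists_of_hasColimits [HasPushouts C] [HasCoproducts.{w} C] {ι : Type w} {A B : ι → C}
    (f : ∀ i, A i ⟶ B i) {X : C} (g : ∀ i, A i ⟶ X) :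
    ∃ (Y : C) (y : X ⟶ Y) (b : ∀ i, B i ⟶ Y), IsCellAttachment f g y b := by
  have := of_isPushout (f := f) (coproductIsCoproduct A) (coproductIsCoproduct B)
    (m := Limits.Sigma.map f) (fun i ↦ Sigma.ι_map f i)
    (IsPushout.of_hasPushout (Sigma.desc g) (Limits.Sigma.map f))
  have e : (fun i ↦ (Cofan.mk (∐ A) (Sigma.ι A)).inj i ≫ Sigma.desc g) = g :=
    funext fun i ↦ Sigma.ι_desc g i
  rw [e] at this
  exact ⟨_, _, _, this⟩

lemma isPushout_of_unique {ι : Type w} [Unique ι] {A B : ι → C} {f : ∀ i, A i ⟶ B i} {X Y : C}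
    {g : ∀ i, A i ⟶ X} {y : X ⟶ Y} {b : ∀ i, B i ⟶ Y} (h : IsCellAttachment f g y b) :
    IsPushout (f default) (g default) (b default) y where
  w := h.w default
  isColimit' := ⟨by
    have key (s : PushoutCocone (f default) (g default)) :=
      h.exists_desc s.inr (fun i ↦ eqToHom (by rw [Unique.eq_default i]) ≫ s.inl) (fun i ↦ by
        obtain rfl := Unique.eq_default i
        rw [eqToHom_refl, Category.id_comp, s.condition])
    choose t ht₁ ht₂ using key
    refine PushoutCocone.IsColimit.mk _ t (fun s ↦ ?_) ht₁ (fun s t' h₁' h₂' ↦ ?_)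
    · simpa using ht₂ s default
    · refine h.hom_ext (h₂'.trans (ht₁ s).symm) fun i ↦ ?_
      obtain rfl := Unique.eq_default i
      simpa [ht₂] using h₁'⟩

/-- The universal property transposes across the adjunction, so no colimits have to exist in either
category. -/
lemma map_of_adjunction {D : Type u'} [Category.{v'} D] {F : C ⥤ D} {R : D ⥤ C} (adj : F ⊣ R)
    {ι : Type w} {A B : ι → C} {f : ∀ i, A i ⟶ B i} {X Y : C}
    {g : ∀ i, A i ⟶ X} {y : X ⟶ Y} {b : ∀ i, B i ⟶ Y} (h : IsCellAttachment f g y b) :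
    IsCellAttachment (fun i ↦ F.map (f i)) (fun i ↦ F.map (g i)) (F.map y)
      (fun i ↦ F.map (b i)) where
  w i := by rw [← F.map_comp, h.w, F.map_comp]
  exists_desc {Z} u v hu := by
    obtain ⟨t, ht₁, ht₂⟩ := h.exists_desc (adj.homEquiv _ _ u) (fun i ↦ adj.homEquiv _ _ (v i))
      (fun i ↦ by rw [← adj.homEquiv_naturality_left, hu, adj.homEquiv_naturality_left])
    refine ⟨(adj.homEquiv _ _).symm t, ?_, fun i ↦ ?_⟩
    · rw [← adj.homEquiv_naturality_left_symm, ht₁, Equiv.symm_apply_apply]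
    · rw [← adj.homEquiv_naturality_left_symm, ht₂, Equiv.symm_apply_apply]
  hom_ext {Z s t} h₁ h₂ := (adj.homEquiv _ _).injective <| h.hom_ext
    (by rw [← adj.homEquiv_naturality_left, h₁, adj.homEquiv_naturality_left])
    (fun i ↦ by rw [← adj.homEquiv_naturality_left, h₂, adj.homEquiv_naturality_left])

/-- Lifts are chosen on each cell separately and glued. -/
lemma llp {ι : Type w} {A B : ι → C} {f : ∀ i, A i ⟶ B i} {X Y : C}
    {g : ∀ i, A i ⟶ X} {y : X ⟶ Y} {b : ∀ i, B i ⟶ Y} (h : IsCellAttachment f g y b)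
    {T : MorphismProperty C} (hf : ∀ i, T.llp (f i)) : T.llp y := by
  intro E B' p hp
  refine ⟨fun {u v} sq ↦ ?_⟩
  have sq' (i : ι) : CommSq (g i ≫ u) (f i) p (b i ≫ v) :=
    ⟨by rw [Category.assoc, sq.w, reassoc_of% h.w]⟩
  have (i : ι) : HasLiftingProperty (f i) p := hf i p hp
  obtain ⟨t, ht₁, ht₂⟩ := h.exists_desc u (fun i ↦ (sq' i).lift) (fun i ↦ (sq' i).fac_left)
  refine ⟨⟨⟨t, ht₁, h.hom_ext ?_ fun i ↦ ?_⟩⟩⟩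
  · rw [reassoc_of% ht₁, sq.w]
  · rw [reassoc_of% (ht₂ i), (sq' i).fac_right]

section

variable {ι : Type w} {A B : ι → C} {f : ∀ i, A i ⟶ B i} {X : C}
  {g : ∀ i, A i ⟶ X} {p q : ι → Prop} (hpq : ∀ i, p i → q i) {P Q : C}
  {y : X ⟶ P} {b : ∀ i : { i // p i }, B i ⟶ P}
  {z : X ⟶ Q} {c : ∀ i : { i // q i }, B i ⟶ Q}
  {t : P ⟶ Q} (ht : y ≫ t = z) (ht' : ∀ i : { i // p i }, b i ≫ t = c ⟨i, hpq i i.2⟩)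

include ht ht' in
-- Cells can be attached in stages: once those in `p` are present, only those in `q` but not in `p`
-- remain. `trans` is the converse, assembling two stages into one.
lemma sdiff (hp : IsCellAttachment (fun i : { i // p i } ↦ f i) (fun i ↦ g i) y b)
    (hq : IsCellAttachment (fun i : { i // q i } ↦ f i) (fun i ↦ g i) z c) :
    IsCellAttachment (fun i : { i // q i ∧ ¬ p i } ↦ f i) (fun i ↦ g i ≫ y) t
      (fun i ↦ c ⟨i, i.2.1⟩) where
  w i := by rw [Category.assoc, ht]; exact hq.w ⟨i, i.2.1⟩
  exists_desc {Z} u v h := by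
    classical
    obtain ⟨s, hs₁, hs₂⟩ := hq.exists_desc (y ≫ u)
      (fun i ↦ if hi : p i then b ⟨i, hi⟩ ≫ u else v ⟨i, i.2, hi⟩) (fun i ↦ by
        split_ifs with hi
        · rw [← Category.assoc, hp.w ⟨i, hi⟩, Category.assoc]
        · rw [h ⟨i, i.2, hi⟩, Category.assoc])
    refine ⟨s, hp.hom_ext (by rw [reassoc_of% ht, hs₁]) fun i ↦ ?_, fun i ↦ ?_⟩
    · rw [← Category.assoc, ht', hs₂, dif_pos i.2]
    · rw [hs₂, dif_neg i.2.2]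
  hom_ext {Z s s'} h h' := hq.hom_ext (by rw [← ht, Category.assoc, h, Category.assoc]) fun i ↦ by
    by_cases hi : p i
    · rw [show c i = b ⟨i, hi⟩ ≫ t from (ht' ⟨i, hi⟩).symm, Category.assoc, h, Category.assoc]
    · exact h' ⟨i, i.2, hi⟩

include ht ht' in
lemma trans (hp : IsCellAttachment (fun i : { i // p i } ↦ f i) (fun i ↦ g i) y b)
    (h : IsCellAttachment (fun i : { i // q i ∧ ¬ p i } ↦ f i) (fun i ↦ g i ≫ y) t
      (fun i ↦ c ⟨i, i.2.1⟩)) :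
    IsCellAttachment (fun i : { i // q i } ↦ f i) (fun i ↦ g i) z c where
  w i := by
    by_cases hi : p i
    · rw [show c i = b ⟨i, hi⟩ ≫ t from (ht' ⟨i, hi⟩).symm, ← Category.assoc,
        hp.w ⟨i, hi⟩, Category.assoc, ht]
    · rw [show c i = c ⟨i, i.2⟩ from rfl, h.w ⟨i, i.2, hi⟩, Category.assoc, ht]
  exists_desc {Z} u v hv := by
    obtain ⟨s, hs₁, hs₂⟩ := hp.exists_desc u (fun i ↦ v ⟨i, hpq i i.2⟩)
      (fun i ↦ hv ⟨i, hpq i i.2⟩)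
    obtain ⟨s', hs₁', hs₂'⟩ := h.exists_desc s (fun i ↦ v ⟨i, i.2.1⟩)
      (fun i ↦ by rw [Category.assoc, hs₁]; exact hv ⟨i, i.2.1⟩)
    refine ⟨s', by rw [← ht, Category.assoc, hs₁', hs₁], fun i ↦ ?_⟩
    by_cases hi : p i
    · rw [show c i = b ⟨i, hi⟩ ≫ t from (ht' ⟨i, hi⟩).symm, Category.assoc, hs₁', hs₂]
    · exact hs₂' ⟨i, i.2, hi⟩
  hom_ext {Z s s'} h₁ h₂ := h.hom_ext
    (hp.hom_ext (by rw [reassoc_of% ht, h₁, reassoc_of% ht]) fun i ↦ by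
      rw [← Category.assoc, ht', h₂, ← ht', Category.assoc])
    fun i ↦ h₂ ⟨i, i.2.1⟩

end

end IsCellAttachment

end CellAttachment

/-! ### Functors preserving cell attachments -/

section Preservation

variable {𝒜 : Type u'} [Category.{v'} 𝒜] [HasPushouts 𝒜] [HasCoproducts.{w} 𝒜]
  {C : Type u} [Category.{v} C] (Φ : 𝒜 ⥤ C) (T : MorphismProperty 𝒜)
  {ι : Type w} {A B : ι → 𝒜} {f : ∀ i, A i ⟶ B i} {X Y : 𝒜}
  {g : ∀ i, A i ⟶ X} {y : X ⟶ Y} {b : ∀ i, B i ⟶ Y}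

namespace IsCellAttachment

include T in
/-- A functor preserves cell attachments if it preserves pushouts of the individual cells and
directed colimits, because one can attach the cells of finite subsets first. -/
lemma map_of_preserves (h : IsCellAttachment f g y b) (hf : ∀ i, T.llp (f i))
    (hpush : ∀ (i : ι) {Z : 𝒜} (k : A i ⟶ Z), PreservesColimit (span (f i) k) Φ)
    (hdir : ∀ (F : Finset ι ⥤ 𝒜), (∀ ⦃i j : Finset ι⦄ (φ : i ⟶ j), T.llp (F.map φ)) →
      PreservesColimit F Φ) :
    IsCellAttachment (fun i ↦ Φ.map (f i)) (fun i ↦ Φ.map (g i)) (Φ.map y)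
      (fun i ↦ Φ.map (b i)) := by
  classical
  -- `P S` is the stage at which only the cells of the finite set `S` have been attached to `X`.
  choose P z c hP using fun S : Finset ι ↦
    exists_of_hasColimits (fun i : { i // i ∈ S } ↦ f i) (fun i ↦ g i)
  choose t ht ht' using fun (S S' : Finset ι) (hS : S ≤ S') ↦
    (hP S).exists_desc (z S') (fun i ↦ c S' ⟨i, hS i.2⟩) (fun i ↦ (hP S').w ⟨i, hS i.2⟩)
  have hsd (S S' : Finset ι) (hS : S ≤ S') := sdiff (fun i hi ↦ hS hi) (ht S S' hS)
    (ht' S S' hS) (hP S) (hP S')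
  have hΦ (S : Finset ι) : IsCellAttachment (fun i : { i // i ∈ S } ↦ Φ.map (f i))
      (fun i ↦ Φ.map (g i)) (Φ.map (z S)) (fun i ↦ Φ.map (c S i)) := by
    induction S using Finset.induction_on with
    | empty =>
      -- With no cells, `z ∅` is an isomorphism with inverse `r`, so its image under `Φ` is again an
      -- attachment of no cells.
      obtain ⟨r, hr, -⟩ := (hP ∅).exists_desc (𝟙 X) (fun i ↦ (Finset.notMem_empty _ i.2).elim)
        (fun i ↦ (Finset.notMem_empty _ i.2).elim)
      have hr' : r ≫ z ∅ = 𝟙 _ := (hP ∅).hom_ext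
        (by rw [reassoc_of% hr, Category.comp_id]) fun i ↦ (Finset.notMem_empty _ i.2).elim
      refine ⟨fun i ↦ (Finset.notMem_empty _ i.2).elim, fun u v _ ↦ ⟨Φ.map r ≫ u, ?_,
        fun i ↦ (Finset.notMem_empty _ i.2).elim⟩, fun {Z s s'} hs _ ↦ ?_⟩
      · rw [← Φ.map_comp_assoc, hr, Φ.map_id, Category.id_comp]
      · have := congrArg (Φ.map r ≫ ·) hs
        simpa only [← Category.assoc, ← Φ.map_comp, hr', Φ.map_id, Category.id_comp] using this
    | insert a S ha hS =>
      have hle : S ≤ insert a S := Finset.subset_insert a S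
      refine trans (f := fun i ↦ Φ.map (f i)) (g := fun i ↦ Φ.map (g i)) (p := fun i ↦ i ∈ S)
        (q := fun i ↦ i ∈ insert a S) (fun i hi ↦ hle hi) (t := Φ.map (t S _ hle)) ?_ (fun i ↦ ?_) hS ?_
      · rw [← Φ.map_comp, ht]
      · rw [← Φ.map_comp, ht']
      -- Passing from `S` to `insert a S` attaches the single cell `a`, that is, a pushout of the
      -- kind preserved by `hpush`.
      · let _ : Unique { i // i ∈ insert a S ∧ i ∉ S } :=
          { default := ⟨a, Finset.mem_insert_self a S, ha⟩
            uniq := fun i ↦ Subtype.ext ((Finset.mem_insert.1 i.2.1).resolve_right i.2.2) }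
        have sq := (hsd S _ hle).isPushout_of_unique
        have := hpush _ (g a ≫ z S)
        have sq' := sq.map Φ
        have hall (i : { i // i ∈ insert a S ∧ i ∉ S }) : i = default := Unique.eq_default i
        refine ⟨fun i ↦ ?_, fun {Z} u v hv ↦ ?_, fun {Z s s'} h₁ h₂ ↦
          sq'.hom_ext (h₂ default) h₁⟩
        · obtain rfl := hall i
          rw [← Φ.map_comp (g _)]
          exact sq'.w
        · obtain ⟨s, hs₁, hs₂⟩ := sq'.exists_desc (v default) u
            (by rw [hv default, ← Φ.map_comp])
          refine ⟨s, hs₂, fun i ↦ ?_⟩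
          obtain rfl := hall i
          exact hs₁
  have tid (S : Finset ι) : t S S le_rfl = 𝟙 _ := (hP S).hom_ext
    (by rw [ht, Category.comp_id]) fun i ↦ by rw [ht', Category.comp_id]
  have tcomp (S S' S'' : Finset ι) (hS : S ≤ S') (hS' : S' ≤ S'') :
      t S S' hS ≫ t S' S'' hS' = t S S'' (hS.trans hS') := (hP S).hom_ext
    (by rw [← Category.assoc, ht, ht, ht]) fun i ↦ by rw [← Category.assoc, ht', ht', ht']
  let F : Finset ι ⥤ 𝒜 :=
    { obj := P
      map := fun φ ↦ t _ _ (leOfHom φ)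
      map_id := tid
      map_comp := fun φ ψ ↦ (tcomp _ _ _ (leOfHom φ) (leOfHom ψ)).symm }
  choose s hs hs' using fun S : Finset ι ↦
    (hP S).exists_desc y (fun i ↦ b i) (fun i ↦ h.w i)
  have ts (S S' : Finset ι) (hS : S ≤ S') : t S S' hS ≫ s S' = s S := (hP S).hom_ext
    (by rw [← Category.assoc, ht, hs, hs]) fun i ↦ by rw [← Category.assoc, ht', hs', hs']
  let cc : Cocone F :=
    { pt := Y
      ι :=
        { app := s
          naturality := fun S S' φ ↦ (ts S S' (leOfHom φ)).trans (Category.comp_id _).symm } }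
  have hcc : Nonempty (IsColimit cc) := by
    -- `Y` is the colimit of the stages: a cocone is determined by its value on `X`, read off at
    -- `∅`, and on each cell, read off at `{i}`.
    have key (k : Cocone F) := h.exists_desc (z ∅ ≫ k.ι.app ∅)
      (fun i ↦ c {i} ⟨i, Finset.mem_singleton_self i⟩ ≫ k.ι.app {i}) (fun i ↦ by
        rw [← Category.assoc, (hP {i}).w ⟨i, Finset.mem_singleton_self i⟩, Category.assoc,
          ← ht ∅ {i} (Finset.empty_subset _), Category.assoc]
        congr 2
        exact k.w (homOfLE (Finset.empty_subset _)))
    choose d hd hd' using key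
    refine ⟨⟨d, fun k S ↦ (hP S).hom_ext ?_ fun i ↦ ?_, fun k m hm ↦ h.hom_ext ?_ fun i ↦ ?_⟩⟩
    · change z S ≫ s S ≫ d k = _
      rw [reassoc_of% hs, hd, ← k.w (homOfLE (Finset.empty_subset S)),
        ← ht ∅ S (Finset.empty_subset _), Category.assoc]
    · change c S i ≫ s S ≫ d k = _
      have hi : ({i.1} : Finset ι) ≤ S := Finset.singleton_subset_iff.2 i.2
      rw [reassoc_of% (hs' S i), hd', ← k.w (homOfLE hi)]
      change _ ≫ t {i.1} S hi ≫ _ = _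
      rw [reassoc_of% (ht' {i.1} S hi ⟨i, Finset.mem_singleton_self _⟩)]
    · rw [hd, ← hm ∅, ← hs ∅, Category.assoc]
    · rw [hd', ← hm {i}, ← hs' {i} ⟨i, Finset.mem_singleton_self i⟩, Category.assoc]
  -- The transition maps attach cells in `T.llp`, so they lie in `T.llp` themselves and the directed
  -- colimit is preserved.
  have := hdir F fun S S' φ ↦ (hsd S S' (leOfHom φ)).llp fun i ↦ hf i
  have hc := isColimitOfPreserves Φ hcc.some
  refine ⟨fun i ↦ by rw [← Φ.map_comp, h.w, Φ.map_comp], fun {Z} u v hv ↦ ?_,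
    fun {Z a a'} h₁ h₂ ↦ hc.hom_ext fun S ↦ (hΦ S).hom_ext ?_ fun i ↦ ?_⟩
  · choose m hm hm' using fun S : Finset ι ↦
      (hΦ S).exists_desc u (fun i ↦ v i) (fun i ↦ hv i)
    let k : Cocone (F ⋙ Φ) :=
      { pt := Z
        ι :=
          { app := m
            naturality := fun S S' φ ↦ by
              refine Eq.trans ?_ (Category.comp_id _).symm
              refine (hΦ S).hom_ext ?_ fun i ↦ ?_
              · change Φ.map (z S) ≫ Φ.map (t S S' (leOfHom φ)) ≫ _ = _
                rw [← Φ.map_comp_assoc, ht, hm, hm]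
              · change Φ.map (c S i) ≫ Φ.map (t S S' (leOfHom φ)) ≫ _ = _
                rw [← Φ.map_comp_assoc, ht', hm', hm'] } }
    have hfac (S : Finset ι) : Φ.map (s S) ≫ hc.desc k = m S := hc.fac k S
    refine ⟨hc.desc k, ?_, fun i ↦ ?_⟩
    · rw [← hs ∅, Φ.map_comp, Category.assoc, hfac, hm]
    · rw [← hs' {i} ⟨i, Finset.mem_singleton_self i⟩, Φ.map_comp, Category.assoc, hfac, hm']
  · change _ ≫ Φ.map (s S) ≫ _ = _ ≫ Φ.map (s S) ≫ _
    rw [← Φ.map_comp_assoc, ← Φ.map_comp_assoc, hs, h₁]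
  · change _ ≫ Φ.map (s S) ≫ _ = _ ≫ Φ.map (s S) ≫ _
    rw [← Φ.map_comp_assoc, ← Φ.map_comp_assoc, hs', h₂]

end IsCellAttachment

end Preservation

/-! ### Free orbits are left adjoint to fixed points -/

section

variable {G : Type v} [Group G] {C : Type u} [Category.{v} C]

section

variable [HasColimits C] {S : Type v} [MulAction G S]

/-- The inclusion of the summand of `s` into `S ⊗ A`. -/
def tensorι (A : C) (s : S) : A ⟶ (tensor (G := G) S A).obj (SingleObj.star G) :=
  Sigma.ι (fun _ : S ↦ A) s

lemma tensorι_map (A : C) (g : G) (s : S) :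
    tensorι A s ≫ (tensor (G := G) S A).map (X := SingleObj.star G) (Y := SingleObj.star G) g =
      tensorι (G := G) A (g • s) :=
  Sigma.ι_desc (fun s : S ↦ Sigma.ι (fun _ : S ↦ A) (g • s)) s

lemma tensorι_tensorMap {A B : C} (f : A ⟶ B) (s : S) :
    tensorι A s ≫ (tensorMap (G := G) S f).app (SingleObj.star G) = f ≫ tensorι B s :=
  Sigma.ι_map (fun _ : S ↦ f) s

lemma tensorι_hom_ext {A Z : C} {φ ψ : (tensor (G := G) S A).obj (SingleObj.star G) ⟶ Z}
    (h : ∀ s : S, tensorι A s ≫ φ = tensorι A s ≫ ψ) : φ = ψ :=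
  Sigma.hom_ext _ _ h

/-- Maps out of the object underlying `S ⊗ A`. -/
def tensorDesc {A Z : C} (k : S → (A ⟶ Z)) :
    (tensor (G := G) S A).obj (SingleObj.star G) ⟶ Z :=
  Sigma.desc k

lemma tensorι_tensorDesc {A Z : C} (k : S → (A ⟶ Z)) (s : S) :
    tensorι A s ≫ tensorDesc (G := G) k = k s :=
  Sigma.ι_desc _ _

lemma tensor_hom_ext {A : C} {X : GObj G C} {φ ψ : tensor (G := G) S A ⟶ X}
    (h : ∀ s : S, tensorι A s ≫ φ.app (SingleObj.star G) =
      tensorι A s ≫ ψ.app (SingleObj.star G)) : φ = ψ := by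
  ext
  exact tensorι_hom_ext h

variable (C S) in
/-- The functor `A ↦ S ⊗ A` for a `G`-set `S`. -/
def tensorFunctor : C ⥤ GObj G C where
  obj A := tensor (G := G) S A
  map f := tensorMap (G := G) S f
  map_id A := tensor_hom_ext fun s ↦ by
    rw [tensorι_tensorMap, NatTrans.id_app, Category.id_comp, Category.comp_id]
  map_comp f g := tensor_hom_ext fun s ↦ by
    rw [tensorι_tensorMap, NatTrans.comp_app, reassoc_of% tensorι_tensorMap,
      tensorι_tensorMap, Category.assoc]

end

section

variable [HasLimits C] [HasColimits C]

/-- Maps `G/K ⊗ A ⟶ X` correspond to maps `A ⟶ X^K`. -/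
def tensorHomEquiv (K : Subgroup G) (A : C) (X : GObj G C) :
    (tensor (G := G) (G ⧸ K) A ⟶ X) ≃ (A ⟶ (fixedPointFunctor C K).obj X) where
  toFun φ := fixedPointsLift K X
    (tensorι A ((1 : G) : G ⧸ K) ≫ φ.app (SingleObj.star G)) fun h hh ↦ by
      rw [Category.assoc, ← φ.naturality, reassoc_of% tensorι_map]
      congr 2
      change ((h * 1 : G) : G ⧸ K) = ((1 : G) : G ⧸ K)
      rw [mul_one, QuotientGroup.eq]
      simpa using hh
  -- By equivariance the summand of `gK` must map by `a` followed by the action of `g`; `evalPoint`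
  -- makes this independent of the representative.
  invFun a :=
    { app := fun _ ↦ tensorDesc fun p : G ⧸ K ↦ a ≫ evalPoint X K p
      naturality := fun _ _ (g : G) ↦ tensorι_hom_ext fun p ↦ by
        refine ((reassoc_of% (tensorι_map A g p)) _).trans ?_
        rw [tensorι_tensorDesc, reassoc_of% tensorι_tensorDesc]
        exact (congrArg (a ≫ ·) (evalPoint_smul X K g p)).trans (Category.assoc _ _ _).symm }
  left_inv φ := tensor_hom_ext fun p ↦ by
    induction p using QuotientGroup.induction_on with
    | H g =>
      refine (tensorι_tensorDesc _ _).trans ?_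
      rw [evalPoint_mk, reassoc_of% fixedPointsLift_ι, Category.assoc, ← φ.naturality,
        reassoc_of% tensorι_map]
      congr 2
      change ((g * 1 : G) : G ⧸ K) = (g : G ⧸ K)
      rw [mul_one]
  right_inv a := fixedPoints_hom_ext _ _ <| by
    rw [fixedPointsLift_ι]
    refine (tensorι_tensorDesc _ _).trans ?_
    rw [evalPoint_mk]
    have : X.map (X := SingleObj.star G) (Y := SingleObj.star G) (1 : G) = 𝟙 _ := X.map_id _
    rw [this, Category.comp_id]

lemma tensorι_tensorHomEquiv_symm (K : Subgroup G) {A : C} {X : GObj G C}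
    (a : A ⟶ (fixedPointFunctor C K).obj X) (p : G ⧸ K) :
    tensorι A p ≫ ((tensorHomEquiv K A X).symm a).app (SingleObj.star G) =
      a ≫ evalPoint X K p :=
  tensorι_tensorDesc _ _

lemma tensorHomEquiv_ι (K : Subgroup G) {A : C} {X : GObj G C}
    (φ : tensor (G := G) (G ⧸ K) A ⟶ X) :
    tensorHomEquiv K A X φ ≫ fixedPointsι K X =
      tensorι A ((1 : G) : G ⧸ K) ≫ φ.app (SingleObj.star G) := by
  rw [tensorHomEquiv, Equiv.coe_fn_mk, fixedPointsLift_ι]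

lemma tensorHomEquiv_naturality_left_symm (K : Subgroup G) {A B : C} {X : GObj G C}
    (f : A ⟶ B) (a : B ⟶ (fixedPointFunctor C K).obj X) :
    (tensorHomEquiv K A X).symm (f ≫ a) =
      tensorMap (G ⧸ K) f ≫ (tensorHomEquiv K B X).symm a :=
  tensor_hom_ext fun p ↦ by
    rw [tensorι_tensorHomEquiv_symm, NatTrans.comp_app, reassoc_of% tensorι_tensorMap,
      tensorι_tensorHomEquiv_symm, Category.assoc]

lemma tensorHomEquiv_naturality_right (K : Subgroup G) {A : C} {X Y : GObj G C}
    (φ : tensor (G := G) (G ⧸ K) A ⟶ X) (f : X ⟶ Y) :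
    tensorHomEquiv K A Y (φ ≫ f) = tensorHomEquiv K A X φ ≫ (fixedPointFunctor C K).map f :=
  fixedPoints_hom_ext _ _ <| by
    rw [tensorHomEquiv_ι, Category.assoc, fixedPointFunctor_map_ι, reassoc_of% tensorHomEquiv_ι,
      NatTrans.comp_app]

variable (C) in
/-- The functor `A ↦ G/K ⊗ A` is left adjoint to the `K`-fixed point functor. -/
def tensorAdjunction (K : Subgroup G) :
    tensorFunctor C (G ⧸ K) ⊣ fixedPointFunctor C K :=
  Adjunction.mkOfHomEquiv
    { homEquiv := tensorHomEquiv K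
      homEquiv_naturality_left_symm := tensorHomEquiv_naturality_left_symm K
      homEquiv_naturality_right := tensorHomEquiv_naturality_right K }

/-- The inclusion of the summand of an `H`-fixed element `s` into the `H`-fixed points of
`S ⊗ A`. -/
def fixedSummand (H : Subgroup G) (S : Type v) [MulAction G S]
    (A : C) (s : MulAction.fixedPoints H S) :
    A ⟶ (fixedPointFunctor C H).obj (tensor (G := G) S A) :=
  Sigma.ι (fun _ : MulAction.fixedPoints H S ↦ A) s ≫ tensorFixedPoints H S A

lemma fixedSummand_ι (H : Subgroup G) (S : Type v)
    [MulAction G S] (A : C) (s : MulAction.fixedPoints H S) :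
    fixedSummand H S A s ≫ fixedPointsι H _ = tensorι A s.1 := by
  rw [fixedSummand, tensorFixedPoints, Sigma.ι_desc]
  exact fixedPointsLift_ι _ _ _ _

lemma fixedSummand_naturality (H : Subgroup G) (S : Type v)
    [MulAction G S] {A B : C} (f : A ⟶ B) (s : MulAction.fixedPoints H S) :
    fixedSummand H S A s ≫ (fixedPointFunctor C H).map (tensorMap S f) =
      f ≫ fixedSummand H S B s :=
  fixedPoints_hom_ext _ _ <| by
    rw [Category.assoc, fixedPointFunctor_map_ι, reassoc_of% fixedSummand_ι, Category.assoc,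
      fixedSummand_ι, tensorι_tensorMap]

/-- If the canonical map is an isomorphism, then `(S ⊗ A)^H` is the coproduct of copies of `A`
indexed by the fixed elements. -/
def isColimitFixedSummand (H : Subgroup G) (S : Type v)
    [MulAction G S] (A : C) [IsIso (tensorFixedPoints (G := G) H S A)] :
    IsColimit (Cofan.mk _ (fixedSummand (G := G) H S A)) :=
  IsColimit.ofIsoColimit (coproductIsCoproduct fun _ : MulAction.fixedPoints H S ↦ A)
    (Cofan.ext (asIso (tensorFixedPoints (G := G) H S A)) fun _ ↦ rfl)

end

/-! ### Underlying cofibrations -/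

/-- The maps of `G`-objects that are cofibrations after forgetting the action. -/
abbrev underlyingCofibrations (G : Type v) [Group G] (C : Type u₁) [Category.{v} C]
    [ModelCategory C] : MorphismProperty (GObj G C) :=
  (cofibrations C).inverseImage (forgetAction G C)

/-- Forgetting the action has a right adjoint, so lifting a trivial fibration against an underlying
map transposes to a lifting problem among `G`-objects. Being defined by a left lifting property,
underlying cofibrations are closed under cell attachment and transfinite composition. -/
lemma exists_underlyingCofibrations_eq_llp (G : Type v) [Group G] (C : Type u₁) [Category.{v} C]
    [HasLimits C] [ModelCategory C] :
    ∃ T : MorphismProperty (GObj G C), underlyingCofibrations G C = T.llp := by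
  have (a b : SingleObj G) : HasProductsOfShape (a ⟶ b) C := by
    change HasProductsOfShape G C
    infer_instance
  refine ⟨(trivialFibrations C).strictMap (evaluationRightAdjoint C (SingleObj.star G)), ?_⟩
  ext X Y f
  change cofibrations C (f.app (SingleObj.star G)) ↔ _
  rw [← MorphismProperty.llp_eq_of_wfs (cofibrations C)
    (trivialFibrations C)]
  constructor
  · rintro h _ _ _ ⟨hp⟩
    exact ((evaluationAdjunctionLeft C (SingleObj.star G)).hasLiftingProperty_iff _ _).1 (h _ hp)
  · intro h _ _ p hp
    exact ((evaluationAdjunctionLeft C (SingleObj.star G)).hasLiftingProperty_iff _ _).2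
      (h _ ⟨hp⟩)

lemma underlyingCofibrations_tensorMap [HasColimits C] [ModelCategory C] (S : Type v)
    [MulAction G S] {A B : C} (f : A ⟶ B) (hf : cofibrations C f) :
    underlyingCofibrations G C (tensorMap (G := G) S f) := by
  change cofibrations C (Limits.Sigma.map fun _ : S ↦ f)
  rw [← MorphismProperty.llp_eq_of_wfs (cofibrations C) (trivialFibrations C)] at hf ⊢
  exact MorphismProperty.colimitsOfShape_le _
    (MorphismProperty.colimitsOfShape_colimMap _ (fun _ ↦ hf))

end

/-! ### Splitting cells into summands, and fixed points of orbit cells -/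

namespace IsCellAttachment

variable {C : Type u} [Category.{v} C]

/-- If the cells are themselves coproducts of maps, then one may attach the summands instead. -/
lemma sigma {ι : Type w} {P Q : ι → C} {f : ∀ i, P i ⟶ Q i} {X Y : C}
    {g : ∀ i, P i ⟶ X} {y : X ⟶ Y} {b : ∀ i, Q i ⟶ Y} (h : IsCellAttachment f g y b)
    {E : ι → Type u'} {A B : (x : Σ i, E i) → C} {k : ∀ x, A x ⟶ B x}
    (a : ∀ x, A x ⟶ P x.1) (c : ∀ x, B x ⟶ Q x.1)
    (ha : ∀ i, Nonempty (IsColimit (Cofan.mk (P i) fun e ↦ a ⟨i, e⟩)))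
    (hc : ∀ i, Nonempty (IsColimit (Cofan.mk (Q i) fun e ↦ c ⟨i, e⟩)))
    (hk : ∀ x, a x ≫ f x.1 = k x ≫ c x) :
    IsCellAttachment k (fun x ↦ a x ≫ g x.1) y (fun x ↦ c x ≫ b x.1) where
  w x := by rw [← reassoc_of% hk, h.w, Category.assoc]
  exists_desc {Z} u v hv := by
    have hfac (i : ι) (e : E i) :
        c ⟨i, e⟩ ≫ Cofan.IsColimit.desc (hc i).some (fun e ↦ v ⟨i, e⟩) = v ⟨i, e⟩ :=
      Cofan.IsColimit.fac (hc i).some _ e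
    obtain ⟨t, ht₁, ht₂⟩ := h.exists_desc u
      (fun i ↦ Cofan.IsColimit.desc (hc i).some fun e ↦ v ⟨i, e⟩) (fun i ↦ by
        refine Cofan.IsColimit.hom_ext (ha i).some _ _ fun e ↦ ?_
        change a ⟨i, e⟩ ≫ _ = a ⟨i, e⟩ ≫ _
        rw [reassoc_of% (hk ⟨i, e⟩), ← Category.assoc (a ⟨i, e⟩), ← hv ⟨i, e⟩]
        exact congrArg (k ⟨i, e⟩ ≫ ·) (hfac i e))
    refine ⟨t, ht₁, fun ⟨i, e⟩ ↦ ?_⟩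
    rw [Category.assoc, ht₂]
    exact hfac i e
  hom_ext {Z s s'} h₁ h₂ := h.hom_ext h₁ fun i ↦
    Cofan.IsColimit.hom_ext (hc i).some _ _ fun e ↦ by
      change c ⟨i, e⟩ ≫ _ = c ⟨i, e⟩ ≫ _
      simpa only [Category.assoc] using h₂ ⟨i, e⟩

variable {G : Type v} [Group G] [HasLimits C] [HasColimits C] [ModelCategory C]

/-- The fixed points of an attachment of cells `G/K ⊗ f` are an attachment of cells `f`. -/
lemma fixedPoints {H : Subgroup G} (hC : IsCellular C H) {ι : Type v} {K : ι → Subgroup G}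
    {A B : ι → C} {f : ∀ i, A i ⟶ B i} (hf : ∀ i, cofibrations C (f i)) {X Y : GObj G C}
    {g : ∀ i, tensor (G := G) (G ⧸ K i) (A i) ⟶ X} {y : X ⟶ Y}
    {b : ∀ i, tensor (G := G) (G ⧸ K i) (B i) ⟶ Y}
    (h : IsCellAttachment (fun i ↦ tensorMap (G := G) (G ⧸ K i) (f i)) g y b) :
    IsCellAttachment (fun x : Σ i, MulAction.fixedPoints H (G ⧸ K i) ↦ f x.1)
      (fun x ↦ fixedSummand H _ _ x.2 ≫ (fixedPointFunctor C H).map (g x.1))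
      ((fixedPointFunctor C H).map y)
      (fun x ↦ fixedSummand H _ _ x.2 ≫ (fixedPointFunctor C H).map (b x.1)) := by
  obtain ⟨T, hT⟩ := exists_underlyingCofibrations_eq_llp G C
  have := hC.isIso_tensorFixedPoints
  have h' := map_of_preserves (fixedPointFunctor C H) T h (fun i ↦ ?_)
    (fun i _ k ↦ hC.preserves_pushouts (K i) (f i) (hf i) _ k)
    (fun F hF ↦ hC.preserves_directed _ F fun _ _ φ ↦ ?_)
  -- The fixed points of the cell `G/K ⊗ f` are a coproduct of copies of `f` indexed by `(G/K)^H`;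
  -- these copies are the new cells.
  · exact h'.sigma (E := fun i ↦ MulAction.fixedPoints H (G ⧸ K i)) (A := fun x ↦ A x.1)
      (B := fun x ↦ B x.1) (k := fun x ↦ f x.1)
      (fun x ↦ fixedSummand H (G ⧸ K x.1) _ x.2) (fun x ↦ fixedSummand H (G ⧸ K x.1) _ x.2)
      (fun i ↦ ⟨isColimitFixedSummand H (G ⧸ K i) _⟩)
      (fun i ↦ ⟨isColimitFixedSummand H (G ⧸ K i) _⟩)
      (fun x ↦ fixedSummand_naturality H _ (f x.1) x.2)
  · rw [← hT]
    exact underlyingCofibrations_tensorMap _ _ (hf i)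
  · have := hF φ
    rwa [← hT] at this

end IsCellAttachment

/-! ### Relative cell complexes of orbit cells -/

section

variable {C : Type u} [Category.{v} C]

/-- A cell attachment gives the cell structure of Mathlib. -/
def IsCellAttachment.attachCells [HasCoproducts.{w} C] {α : Type u'} {A B : α → C}
    {k : ∀ a, A a ⟶ B a} {ι : Type w} {π : ι → α} {X Y : C} {g : ∀ i, A (π i) ⟶ X} {y : X ⟶ Y}
    {b : ∀ i, B (π i) ⟶ Y} (h : IsCellAttachment (fun i ↦ k (π i)) g y b) :
    AttachCells.{w} k y where
  ι := ι
  π := π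
  cofan₁ := _
  cofan₂ := _
  isColimit₁ := coproductIsCoproduct _
  isColimit₂ := coproductIsCoproduct _
  m := Limits.Sigma.map fun i ↦ k (π i)
  hm i := Sigma.ι_map (fun i ↦ k (π i)) i
  g₁ := _
  g₂ := _
  isPushout := h.isPushout (coproductIsCoproduct _) (coproductIsCoproduct _)
    (fun i ↦ Sigma.ι_map (fun i ↦ k (π i)) i)

lemma isCellAttachment_of_attachCells {α : Type u'} {A B : α → C}
    {k : ∀ a, A a ⟶ B a} {X Y : C} {y : X ⟶ Y} (c : AttachCells.{w} k y) :
    IsCellAttachment (fun i ↦ k (c.π i)) (fun i ↦ c.cofan₁.inj i ≫ c.g₁) y c.cell :=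
  .of_isPushout c.isColimit₁ c.isColimit₂ c.hm c.isPushout

/-- The class of the maps `G/K ⊗ f`, where `K` is a subgroup of `G` and `f` is in a given class. -/
def orbitCells (G : Type v) [Group G] [HasColimits C] (M : MorphismProperty C) :
    MorphismProperty (GObj G C) :=
  .ofHoms fun x : Subgroup G × M.toSet ↦ tensorMap (G := G) (G ⧸ x.1) x.2.1.hom

variable {G : Type v} [Group G] [HasColimits C] {M : MorphismProperty C}

instance [MorphismProperty.IsSmall.{v} M] : MorphismProperty.IsSmall.{v} (orbitCells G M) := by
  unfold orbitCells
  infer_instance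

lemma orbitCells_tensorMap (K : Subgroup G) {A B : C} (f : A ⟶ B) (hf : M f) :
    orbitCells G M (tensorMap (G ⧸ K) f) :=
  ⟨((K, ⟨Arrow.mk f, hf⟩) : Subgroup G × M.toSet)⟩

/-- Lifting problems transpose along `tensorAdjunction`. -/
lemma orbitCells_rlp_iff [HasLimits C] {X Y : GObj G C} (p : X ⟶ Y) :
    (orbitCells G M).rlp p ↔ ∀ K : Subgroup G, M.rlp ((fixedPointFunctor C K).map p) := by
  constructor
  · intro h K A B f hf
    exact ((tensorAdjunction C K).hasLiftingProperty_iff f p).1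
      (h _ (orbitCells_tensorMap K f hf))
  · rintro h _ _ _ ⟨⟨K, f, hf⟩⟩
    exact ((tensorAdjunction C K).hasLiftingProperty_iff f.hom p).2 (h K _ hf)

/-- Attaching cells of the class `orbitCells G M` amounts to attaching cells `G/K ⊗ f`. -/
lemma exists_isCellAttachment_of_attachCells_orbitCells {X Y : GObj G C} {y : X ⟶ Y}
    (c : AttachCells.{v} (orbitCells G M).homFamily y) :
    ∃ (ι : Type v) (K : ι → Subgroup G) (m : ι → M.toSet)
      (g : ∀ i, tensor (G := G) (G ⧸ K i) (m i).1.left ⟶ X)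
      (b : ∀ i, tensor (G := G) (G ⧸ K i) (m i).1.right ⟶ Y),
      IsCellAttachment (fun i ↦ tensorMap (G := G) (G ⧸ K i) (m i).1.hom) g y b := by
  -- Membership in `orbitCells` only says that a presentation `G/K ⊗ f` exists; one is chosen for
  -- each map and the cells are reindexed accordingly.
  have key (a : (orbitCells G M).toSet) : ∃ x : Subgroup G × M.toSet,
      Arrow.mk ((orbitCells G M).homFamily a) =
        Arrow.mk (tensorMap (G := G) (G ⧸ x.1) x.2.1.hom) :=
    (MorphismProperty.ofHoms_iff _ _).1 a.2
  choose x hx using key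
  exact ⟨_, _, _, _, _, isCellAttachment_of_attachCells
    (c.reindexCellTypes (fun x : Subgroup G × M.toSet ↦ tensorMap (G := G) (G ⧸ x.1) x.2.1.hom)
      x fun a ↦ eqToIso (hx a))⟩

lemma orbitCells_le_underlyingCofibrations [ModelCategory C] (hM : M ≤ cofibrations C) :
    orbitCells G M ≤ underlyingCofibrations G C := by
  rintro _ _ _ ⟨⟨K, f, hf⟩⟩
  exact underlyingCofibrations_tensorMap _ _ (hM _ hf)

variable [HasLimits C] [ModelCategory C]

/-- This verifies the hypothesis of the directed colimit axiom of `IsCellular` along a complex of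
orbit cells. -/
lemma underlyingCofibrations_relativeCellComplex_map (hM : M ≤ cofibrations C) {J : Type v}
    [LinearOrder J] [OrderBot J] [SuccOrder J] [WellFoundedLT J] {X Y : GObj G C} {f : X ⟶ Y}
    (c : RelativeCellComplex.{v} (fun _ : J ↦ (orbitCells G M).homFamily) f) {i j : J}
    (φ : i ⟶ j) : underlyingCofibrations G C (c.F.map φ) := by
  obtain ⟨T, hT⟩ := exists_underlyingCofibrations_eq_llp G C
  have hle := orbitCells_le_underlyingCofibrations (G := G) hM
  rw [hT] at hle ⊢
  exact (c.transfiniteCompositionOfShape.ofLE (W' := T.llp) (by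
    rw [MorphismProperty.ofHoms_homFamily]
    refine (MorphismProperty.pushouts_monotone
      (MorphismProperty.coproducts_monotone hle)).trans ?_
    simp)).mem_map φ

/-- Cellular fixed point functors preserve the colimits occurring in relative cell complexes. -/
lemma IsCellular.preservesColimit_relativeCellComplex {H : Subgroup G} (hC : IsCellular C H)
    (hM : M ≤ cofibrations C) {J : Type v}
    [LinearOrder J] [OrderBot J] [SuccOrder J] [WellFoundedLT J] {X Y : GObj G C} {f : X ⟶ Y}
    (c : RelativeCellComplex.{v} (fun _ : J ↦ (orbitCells G M).homFamily) f)
    {P : Type v} [LinearOrder P] [Nonempty P] (F : P ⥤ J) :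
    PreservesColimit (F ⋙ c.F) (fixedPointFunctor C H) :=
  hC.preserves_directed P (F ⋙ c.F) fun _ _ φ ↦
    underlyingCofibrations_relativeCellComplex_map hM c (F.map φ)

/-- The fixed points of a relative cell complex of orbit cells are a relative cell complex. -/
def relativeCellComplexFixedPoints {H : Subgroup G} (hC : IsCellular C H)
    (hM : M ≤ cofibrations C) {J : Type v}
    [LinearOrder J] [OrderBot J] [SuccOrder J] [WellFoundedLT J] {X Y : GObj G C} {f : X ⟶ Y}
    (c : RelativeCellComplex.{v} (fun _ : J ↦ (orbitCells G M).homFamily) f) :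
    RelativeCellComplex.{v} (fun _ : J ↦ M.homFamily) ((fixedPointFunctor C H).map f) where
  F := c.F ⋙ fixedPointFunctor C H
  isoBot := (fixedPointFunctor C H).mapIso c.isoBot
  isWellOrderContinuous := ⟨fun m hm ↦ by
    -- The directed colimit axiom covers only nonempty posets; at a limit stage `⊥` lies below `m`.
    have : Nonempty (Set.Iio m) := ⟨⟨⊥, Order.IsSuccLimit.bot_lt hm⟩⟩
    have := hC.preservesColimit_relativeCellComplex hM c
      (Set.principalSegIio m).monotone.functor
    exact ⟨IsColimit.ofIsoColimit (isColimitOfPreserves (fixedPointFunctor C H)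
      (c.F.isColimitOfIsWellOrderContinuous m hm))
      (Cocone.ext (Iso.refl _) fun _ ↦ Category.comp_id _)⟩⟩
  incl := Functor.whiskerRight c.incl (fixedPointFunctor C H) ≫ (Functor.constComp _ _ _).hom
  isColimit := by
    have := hC.preservesColimit_relativeCellComplex hM c (𝟭 J)
    have : PreservesColimit c.F (fixedPointFunctor C H) := this
    exact IsColimit.ofIsoColimit (isColimitOfPreserves (fixedPointFunctor C H) c.isColimit)
      (Cocone.ext (Iso.refl _))
  fac := by
    refine Eq.trans ?_ (congrArg (fixedPointFunctor C H).map c.fac)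
    refine Eq.trans ?_ ((fixedPointFunctor C H).map_comp _ _).symm
    simp
  attachCells j hj := Nonempty.some <| by
    obtain ⟨ι, K, m, g, b, h⟩ :=
      exists_isCellAttachment_of_attachCells_orbitCells (c.attachCells j hj)
    exact ⟨IsCellAttachment.attachCells (k := M.homFamily)
      (π := fun x : Σ i, MulAction.fixedPoints H (G ⧸ K i) ↦ m x.1)
      (h.fixedPoints hC fun i ↦ hM _ (m i).2)⟩

/-- The class `orbitCells G M` permits the small object argument if `M` does. -/
lemma hasSmallObjectArgument_orbitCells (hC : ∀ H : Subgroup G, IsCellular C H)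
    (hM : M ≤ cofibrations C) [MorphismProperty.HasSmallObjectArgument.{v} M] :
    MorphismProperty.HasSmallObjectArgument.{v} (orbitCells G M) := by
  obtain ⟨κ, hκ, hbot, h⟩ := MorphismProperty.HasSmallObjectArgument.exists_cardinal (I := M)
  have := SmallObject.isSmall M κ
  -- The cardinal for `M` also serves for orbit cells: maps out of `G/K ⊗ A` are maps from `A` to
  -- `K`-fixed points, and the `K`-fixed points of a complex of orbit cells are an `M`-complex, for
  -- which `A` is small.
  refine ⟨κ, hκ, hbot, ?_⟩
  exact
    { preservesColimit := by
        rintro _ _ X Y _ ⟨⟨K, i, hi⟩⟩ f hf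
        have h₁ := SmallObject.preservesColimit M κ i.hom hi _
          (relativeCellComplexFixedPoints (hC K) hM hf)
        have h₂ : PreservesColimit hf.F (fixedPointFunctor C K) :=
          (hC K).preservesColimit_relativeCellComplex hM hf (𝟭 _)
        have h₃ : PreservesColimit hf.F
            (fixedPointFunctor C K ⋙ coyoneda.obj (Opposite.op i.left)) :=
          have : PreservesColimit (hf.F ⋙ fixedPointFunctor C K)
            (coyoneda.obj (Opposite.op i.left)) := h₁
          inferInstance
        let e : fixedPointFunctor C K ⋙ coyoneda.obj (Opposite.op i.left) ≅
            coyoneda.obj (Opposite.op (tensor (G ⧸ K) i.left)) :=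
          NatIso.ofComponents (fun Z ↦ (tensorHomEquiv K i.left Z).toIso.symm) fun {Z Z'} φ ↦ by
            ext a
            change (tensorHomEquiv K i.left Z').symm (a ≫ (fixedPointFunctor C K).map φ) =
              (tensorHomEquiv K i.left Z).symm a ≫ φ
            rw [Equiv.symm_apply_eq, tensorHomEquiv_naturality_right, Equiv.apply_symm_apply]
        exact preservesColimit_of_natIso hf.F e }

/-- Fixed points of relative cofibrations for `orbitCells G M` are relative cofibrations for
`M`. -/
lemma fixedPoints_map_llp_rlp (hC : ∀ H : Subgroup G, IsCellular C H)
    (hM : M ≤ cofibrations C) [MorphismProperty.HasSmallObjectArgument.{v} M]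
    {X Y : GObj G C} (f : X ⟶ Y) (hf : (orbitCells G M).rlp.llp f) (H : Subgroup G) :
    M.rlp.llp ((fixedPointFunctor C H).map f) := by
  have := hasSmallObjectArgument_orbitCells hC hM
  obtain ⟨κ, _, _, _⟩ :=
    MorphismProperty.HasSmallObjectArgument.exists_cardinal (I := orbitCells G M)
  -- The small object argument factors `f` through a complex of orbit cells, whose fixed points are
  -- an `M`-complex. Lifting `f` against the second factor makes `f` a retract of this complex.
  have hι := M.transfiniteCompositionsOfShape_pushouts_coproducts_le_llp_rlp _ _
    ⟨(relativeCellComplexFixedPoints (hC H) hM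
      (SmallObject.relativeCellComplexιObj (orbitCells G M) κ f)).transfiniteCompositionOfShape'
      (I := M) fun s ↦ s.i.2⟩
  have sq : CommSq (SmallObject.ιObj (orbitCells G M) κ f) f
    (SmallObject.πObj (orbitCells G M) κ f) (𝟙 _) := ⟨by simp⟩
  have := hf _ (SmallObject.rlp_πObj (orbitCells G M) κ f)
  let r : RetractArrow f (SmallObject.ιObj (orbitCells G M) κ f) :=
    { i := Arrow.homMk (𝟙 _) sq.lift
      r := Arrow.homMk (𝟙 _) (SmallObject.πObj (orbitCells G M) κ f) }
  exact MorphismProperty.of_retract (r.map (fixedPointFunctor C H)) hι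

end

/-! ### The fixed point model structure -/

section

variable {C : Type u} [Category.{v} C] [ModelCategory C]

lemma le_cofibrations_of_trivialFibrations_eq_rlp {I : MorphismProperty C}
    (hI : trivialFibrations C = I.rlp) : I ≤ cofibrations C := by
  rw [← MorphismProperty.llp_eq_of_wfs (cofibrations C) (trivialFibrations C), hI]
  exact I.le_llp_rlp

lemma le_cofibrations_of_fibrations_eq_rlp {J : MorphismProperty C}
    (hJ : fibrations C = J.rlp) : J ≤ cofibrations C := by
  refine le_trans ?_ (trivialCofibrations_sub_cofibrations C)
  rw [← MorphismProperty.llp_eq_of_wfs (trivialCofibrations C) (fibrations C), hJ]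
  exact J.le_llp_rlp

end

section

variable {G : Type v} [Group G] {C : Type u} [Category.{v} C] [HasLimits C]

lemma functorCategory_inverseImage_orbitDiagram_iff (W : MorphismProperty C) {X Y : GObj G C}
    (f : X ⟶ Y) :
    (W.functorCategory (OrbitCategory G)ᵒᵖ).inverseImage (orbitDiagram G C) f ↔
      ∀ H : Subgroup G, W ((fixedPointFunctor C H).map f) :=
  ⟨fun h H ↦ h (Opposite.op ⟨H⟩), fun h H ↦ h H.unop.stab⟩

variable [ModelCategory C]

namespace IsFixedPointModelStructure

variable {m : ModelCategory (GObj G C)} (hm : IsFixedPointModelStructure m)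

include hm

lemma fibrations_iff {X Y : GObj G C} (f : X ⟶ Y) :
    fibrations (GObj G C) f ↔ ∀ H : Subgroup G, fibrations C ((fixedPointFunctor C H).map f) := by
  rw [hm.fibrations_eq, functorCategory_inverseImage_orbitDiagram_iff]

lemma weakEquivalences_iff {X Y : GObj G C} (f : X ⟶ Y) :
    weakEquivalences (GObj G C) f ↔
      ∀ H : Subgroup G, weakEquivalences C ((fixedPointFunctor C H).map f) := by
  rw [hm.weakEquivalences_eq, functorCategory_inverseImage_orbitDiagram_iff]

lemma trivialFibrations_iff {X Y : GObj G C} (f : X ⟶ Y) :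
    trivialFibrations (GObj G C) f ↔
      ∀ H : Subgroup G, trivialFibrations C ((fixedPointFunctor C H).map f) := by
  change _ ∧ _ ↔ _
  rw [hm.fibrations_iff, hm.weakEquivalences_iff, ← forall_and]
  rfl

/-- Cofibrations are determined by the trivial fibrations, so every fixed point model structure,
however obtained, is generated by orbit cells. -/
lemma cofibrations_eq [HasColimits C] {I : MorphismProperty C}
    (hI : trivialFibrations C = I.rlp) :
    cofibrations (GObj G C) = (orbitCells G I).rlp.llp := by
  rw [← MorphismProperty.llp_eq_of_wfs (cofibrations (GObj G C)) (trivialFibrations (GObj G C))]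
  congr 1
  ext X Y f
  rw [hm.trivialFibrations_iff, orbitCells_rlp_iff, hI]

end IsFixedPointModelStructure

variable (G C) in
/-- If the fixed point functors are cellular, then the fixed point model structure exists. -/
theorem exists_isFixedPointModelStructure [HasColimits C] [IsCofibrantlyGenerated C]
    (hC : ∀ H : Subgroup G, IsCellular C H) :
    ∃ m : ModelCategory (GObj G C), IsFixedPointModelStructure m := by
  obtain ⟨I, J, _, _, hI, hJ⟩ := IsCofibrantlyGenerated.exists_generators (C := C)
  have hI' := le_cofibrations_of_trivialFibrations_eq_rlp hI
  have hJ' := le_cofibrations_of_fibrations_eq_rlp hJ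
  have := hasSmallObjectArgument_orbitCells hC hI'
  have := hasSmallObjectArgument_orbitCells hC hJ'
  let _ : CategoryWithFibrations (GObj G C) :=
    ⟨((fibrations C).functorCategory (OrbitCategory G)ᵒᵖ).inverseImage (orbitDiagram G C)⟩
  let _ : CategoryWithWeakEquivalences (GObj G C) :=
    ⟨((weakEquivalences C).functorCategory (OrbitCategory G)ᵒᵖ).inverseImage (orbitDiagram G C)⟩
  let _ : CategoryWithCofibrations (GObj G C) := ⟨(orbitCells G I).rlp.llp⟩
  have hW {X Y : GObj G C} (f : X ⟶ Y) : weakEquivalences (GObj G C) f ↔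
      ∀ H : Subgroup G, weakEquivalences C ((fixedPointFunctor C H).map f) :=
    functorCategory_inverseImage_orbitDiagram_iff _ _
  have hcof : cofibrations (GObj G C) = (orbitCells G I).rlp.llp := rfl
  have hfib : fibrations (GObj G C) = (orbitCells G J).rlp := by
    ext X Y f
    rw [orbitCells_rlp_iff, ← hJ]
    exact functorCategory_inverseImage_orbitDiagram_iff _ _
  have htf : trivialFibrations (GObj G C) = (orbitCells G I).rlp := by
    ext X Y f
    change _ ∧ _ ↔ _
    rw [hfib, orbitCells_rlp_iff, orbitCells_rlp_iff, hW, ← hJ, ← hI, ← forall_and]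
    rfl
  have : (weakEquivalences (GObj G C)).HasTwoOutOfThreeProperty :=
    { comp_mem := fun f g hf hg ↦ (hW _).2 fun H ↦ by
        rw [Functor.map_comp]
        exact MorphismProperty.comp_mem _ _ _ ((hW f).1 hf H) ((hW g).1 hg H)
      of_postcomp := fun f g hg hfg ↦ (hW _).2 fun H ↦ by
        have := (hW _).1 hfg H
        rw [Functor.map_comp] at this
        exact MorphismProperty.of_postcomp _ _ _ ((hW g).1 hg H) this
      of_precomp := fun f g hf hfg ↦ (hW _).2 fun H ↦ by
        have := (hW _).1 hfg H
        rw [Functor.map_comp] at this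
        exact MorphismProperty.of_precomp _ _ _ ((hW f).1 hf H) this }
  have htf_le : trivialFibrations (GObj G C) ≤ fibrations (GObj G C) :=
    trivialFibrations_sub_fibrations _
  have htc : trivialCofibrations (GObj G C) = (orbitCells G J).rlp.llp := by
    apply le_antisymm
    · rintro X Y f ⟨hf₁, hf₂⟩
      -- Retract argument: `d.i` is a weak equivalence because its fixed points are trivial
      -- cofibrations. By two out of three `d.p` is a trivial fibration, so `f` lifts against it and
      -- is a retract of `d.i`.
      let d := MorphismProperty.factorizationData (orbitCells G J).rlp.llp (orbitCells G J).rlp f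
      have hi : weakEquivalences (GObj G C) d.i := (hW _).2 fun H ↦ by
        have := fixedPoints_map_llp_rlp hC hJ' d.i d.hi H
        rw [← hJ, MorphismProperty.llp_eq_of_wfs (trivialCofibrations C)] at this
        exact this.2
      have hp : trivialFibrations (GObj G C) d.p :=
        ⟨by rw [hfib]; exact d.hp, MorphismProperty.of_precomp _ _ _ hi (by rwa [d.fac])⟩
      rw [htf] at hp
      have sq : CommSq d.i f d.p (𝟙 _) := ⟨by simp⟩
      have := hf₁ _ hp
      have r : RetractArrow f d.i :=
        { i := Arrow.homMk (𝟙 _) sq.lift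
          r := Arrow.homMk (𝟙 _) d.p }
      exact MorphismProperty.of_retract r d.hi
    · intro X Y f hf
      refine ⟨?_, (hW _).2 fun H ↦ ?_⟩
      · rw [hcof, ← htf]
        rw [← hfib] at hf
        exact MorphismProperty.antitone_llp htf_le _ hf
      · have := fixedPoints_map_llp_rlp hC hJ' f hf H
        rw [← hJ, MorphismProperty.llp_eq_of_wfs (trivialCofibrations C)] at this
        exact this.2
  have : MorphismProperty.IsWeakFactorizationSystem (cofibrations (GObj G C))
      (trivialFibrations (GObj G C)) := by
    rw [hcof, htf]
    exact { rlp := MorphismProperty.rlp_llp_rlp _, llp := rfl }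
  have : MorphismProperty.IsWeakFactorizationSystem (trivialCofibrations (GObj G C))
      (fibrations (GObj G C)) := by
    rw [htc, hfib]
    exact { rlp := MorphismProperty.rlp_llp_rlp _, llp := rfl }
  exact ⟨ModelCategory.mk' _, ⟨rfl, rfl⟩⟩

end

/-! ### Comparison of fixed points along a functor -/

section

variable {G : Type v} [Group G] {C : Type u₁} [Category.{v} C] [HasLimits C]
  {D : Type u₂} [Category.{v} D]

/-- Composition of `G`-objects with a functor. -/
abbrev mapGObj (G : Type v) [Group G] (F : C ⥤ D) : GObj G C ⥤ GObj G D :=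
  (Functor.whiskeringRight (SingleObj G) C D).obj F

lemma map_fixedPointsι_comp_map (F : C ⥤ D) (H : Subgroup G) (X : GObj G C) (h : G)
    (hh : h ∈ H) : F.map (fixedPointsι H X) ≫
      ((mapGObj G F).obj X).map (X := SingleObj.star G) (Y := SingleObj.star G) h =
        F.map (fixedPointsι H X) :=
  (F.map_comp _ _).symm.trans (congrArg F.map (fixedPointsι_map H X h hh))

variable [HasLimits D]

/-- The canonical map `F (X^H) ⟶ (F X)^H`. -/
def fixedPointsComparison (F : C ⥤ D) (H : Subgroup G) :
    fixedPointFunctor C H ⋙ F ⟶ mapGObj G F ⋙ fixedPointFunctor D H where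
  app X := fixedPointsLift H ((mapGObj G F).obj X) (F.map (fixedPointsι H X))
    (map_fixedPointsι_comp_map F H X)
  naturality X Y f := fixedPoints_hom_ext _ _ <| by
    rw [Category.assoc, Category.assoc, fixedPointsLift_ι, Functor.comp_map, Functor.comp_map,
      fixedPointFunctor_map_ι, reassoc_of% fixedPointsLift_ι, ← F.map_comp,
      fixedPointFunctor_map_ι, F.map_comp]
    rfl

lemma fixedPointsComparison_app_ι (F : C ⥤ D) (H : Subgroup G) (X : GObj G C) :
    (fixedPointsComparison F H).app X ≫ fixedPointsι H ((mapGObj G F).obj X) =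
      F.map (fixedPointsι H X) :=
  fixedPointsLift_ι _ _ _ (map_fixedPointsι_comp_map F H X)

instance isIso_fixedPointsComparison (F : C ⥤ D) (H : Subgroup G)
    [PreservesLimitsOfShape (SingleObj H) F] : IsIso (fixedPointsComparison F H) := by
  have (X : GObj G C) : IsIso ((fixedPointsComparison F H).app X) := by
    have : (fixedPointsComparison F H).app X = (preservesLimitIso F (subgroupIncl H ⋙ X)).hom :=
      fixedPoints_hom_ext _ _ <| (fixedPointsComparison_app_ι F H X).trans
        (preservesLimitIso_hom_π F (subgroupIncl H ⋙ X) (SingleObj.star H)).symm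
    rw [this]
    exact Iso.isIso_hom (preservesLimitIso F (subgroupIncl H ⋙ X))
  exact NatIso.isIso_of_isIso_app _

/-- The comparison isomorphism identifies the two arrows; this is applied to the right adjoint `R`.
-/
lemma fixedPointFunctor_map_mapGObj_iff (F : C ⥤ D) (H : Subgroup G)
    [PreservesLimitsOfShape (SingleObj H) F] (W : MorphismProperty D) [W.RespectsIso]
    {X Y : GObj G C} (f : X ⟶ Y) :
    W ((fixedPointFunctor D H).map ((mapGObj G F).map f)) ↔
      W (F.map ((fixedPointFunctor C H).map f)) :=
  (W.arrow_mk_iso_iff (((Functor.mapArrowFunctor _ _).mapIso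
    (asIso (fixedPointsComparison F H))).app (Arrow.mk f))).symm

/-- The comparison maps for both adjoints are compatible with adjunction. -/
lemma homEquiv_fixedPointsComparison {L : C ⥤ D} {R : D ⥤ C} (adj : L ⊣ R) (H : Subgroup G)
    {X : GObj G C} {Y : GObj G D} (f : (mapGObj G L).obj X ⟶ Y) :
    adj.homEquiv _ _ ((fixedPointsComparison L H).app X ≫ (fixedPointFunctor D H).map f) ≫
      (fixedPointsComparison R H).app Y =
        (fixedPointFunctor C H).map ((adj.whiskerRight (SingleObj G)).homEquiv X Y f) :=
  fixedPoints_hom_ext _ _ <| by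
    have h₁ : ((adj.whiskerRight (SingleObj G)).homEquiv X Y f).app (SingleObj.star G) =
        adj.homEquiv _ _ (f.app (SingleObj.star G)) := by
      rw [adj.homEquiv_unit, (adj.whiskerRight (SingleObj G)).homEquiv_unit X Y f]
      simp
    rw [Category.assoc, fixedPointsComparison_app_ι, ← adj.homEquiv_naturality_right,
      Category.assoc, fixedPointFunctor_map_ι, fixedPointFunctor_map_ι,
      reassoc_of% fixedPointsComparison_app_ι, adj.homEquiv_naturality_left, h₁]

end

/-! ### Quillen adjunctions -/

section

variable {G : Type v} [Group G] {C : Type u₁} [Category.{v} C] [ModelCategory C]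
  {D : Type u₂} [Category.{v} D] [ModelCategory D] {L : C ⥤ D} {R : D ⥤ C} {adj : L ⊣ R}

lemma IsQuillenAdjunction.fibrations_map (h : IsQuillenAdjunction adj) {X Y : D} (p : X ⟶ Y)
    (hp : fibrations D p) : fibrations C (R.map p) := by
  rw [← MorphismProperty.rlp_eq_of_wfs (trivialCofibrations C) (fibrations C)]
  intro A B i hi
  rw [← adj.hasLiftingProperty_iff]
  exact MorphismProperty.hasLiftingProperty_of_wfs _ _ (h.trivialCofibrations_map i hi) hp

lemma IsQuillenAdjunction.trivialFibrations_map (h : IsQuillenAdjunction adj) {X Y : D}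
    (p : X ⟶ Y) (hp : trivialFibrations D p) : trivialFibrations C (R.map p) := by
  rw [← MorphismProperty.rlp_eq_of_wfs (cofibrations C) (trivialFibrations C)]
  intro A B i hi
  rw [← adj.hasLiftingProperty_iff]
  exact MorphismProperty.hasLiftingProperty_of_wfs _ _ (h.cofibrations_map i hi) hp

lemma IsQuillenAdjunction.of_fibrations_map
    (h₁ : ∀ ⦃X Y : D⦄ (p : X ⟶ Y), fibrations D p → fibrations C (R.map p))
    (h₂ : ∀ ⦃X Y : D⦄ (p : X ⟶ Y), trivialFibrations D p → trivialFibrations C (R.map p)) :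
    IsQuillenAdjunction adj where
  cofibrations_map A B i hi := by
    rw [← MorphismProperty.llp_eq_of_wfs (cofibrations D) (trivialFibrations D)]
    intro X Y p hp
    rw [adj.hasLiftingProperty_iff]
    exact MorphismProperty.hasLiftingProperty_of_wfs _ _ hi (h₂ p hp)
  trivialCofibrations_map A B i hi := by
    rw [← MorphismProperty.llp_eq_of_wfs (trivialCofibrations D) (fibrations D)]
    intro X Y p hp
    rw [adj.hasLiftingProperty_iff]
    exact MorphismProperty.hasLiftingProperty_of_wfs _ _ hi (h₁ p hp)

/-- A Quillen adjunction induces a Quillen adjunction between fixed point model structures. -/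
theorem IsQuillenAdjunction.whiskerRight [HasLimits C] [HasLimits D]
    (h : IsQuillenAdjunction adj) {mC : ModelCategory (GObj G C)} {mD : ModelCategory (GObj G D)}
    (hmC : IsFixedPointModelStructure mC) (hmD : IsFixedPointModelStructure mD) :
    IsQuillenAdjunction (adj.whiskerRight (SingleObj G)) := by
  have (H : Subgroup G) : PreservesLimitsOfShape (SingleObj H) R :=
    adj.rightAdjoint_preservesLimits.preservesLimitsOfShape
  have : (trivialFibrations C).RespectsIso := by
    rw [← MorphismProperty.rlp_eq_of_wfs (cofibrations C) (trivialFibrations C)]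
    infer_instance
  refine .of_fibrations_map (fun X Y p hp ↦ ?_) (fun X Y p hp ↦ ?_)
  · rw [hmD.fibrations_iff] at hp
    rw [hmC.fibrations_iff]
    exact fun H ↦ (fixedPointFunctor_map_mapGObj_iff R H _ p).2 (h.fibrations_map _ (hp H))
  · rw [hmD.trivialFibrations_iff] at hp
    rw [hmC.trivialFibrations_iff]
    exact fun H ↦ (fixedPointFunctor_map_mapGObj_iff R H _ p).2
      (h.trivialFibrations_map _ (hp H))

end

/-! ### Comparing cell attachments -/

namespace IsCellAttachment

variable {C : Type u} [Category.{v} C] {ι : Type w} {A B : ι → C} {f : ∀ i, A i ⟶ B i}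

lemma of_iso {A' B' : ι → C} {f' : ∀ i, A' i ⟶ B' i} {X Y : C} {g : ∀ i, A i ⟶ X} {y : X ⟶ Y}
    {b : ∀ i, B i ⟶ Y} (h : IsCellAttachment f g y b) (eA : ∀ i, A' i ≅ A i)
    (eB : ∀ i, B' i ≅ B i) (he : ∀ i, (eA i).hom ≫ f i = f' i ≫ (eB i).hom) :
    IsCellAttachment f' (fun i ↦ (eA i).hom ≫ g i) y (fun i ↦ (eB i).hom ≫ b i) where
  w i := by rw [← reassoc_of% he, h.w, Category.assoc]
  exists_desc {Z} u v hv := by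
    obtain ⟨t, ht₁, ht₂⟩ := h.exists_desc u (fun i ↦ (eB i).inv ≫ v i) (fun i ↦ by
      rw [← cancel_epi (eA i).hom, reassoc_of% he, Iso.hom_inv_id_assoc, hv, Category.assoc])
    exact ⟨t, ht₁, fun i ↦ by rw [Category.assoc, ht₂, Iso.hom_inv_id_assoc]⟩
  hom_ext h₁ h₂ := h.hom_ext h₁ fun i ↦ by
    rw [← cancel_epi (eB i).hom, ← Category.assoc, ← Category.assoc, h₂]

/-- Two objects obtained by attaching the same cells to isomorphic objects are isomorphic. -/
lemma isIso {X₁ Y₁ X₂ Y₂ : C} {g₁ : ∀ i, A i ⟶ X₁} {y₁ : X₁ ⟶ Y₁} {b₁ : ∀ i, B i ⟶ Y₁}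
    {g₂ : ∀ i, A i ⟶ X₂} {y₂ : X₂ ⟶ Y₂} {b₂ : ∀ i, B i ⟶ Y₂} (h₁ : IsCellAttachment f g₁ y₁ b₁)
    (h₂ : IsCellAttachment f g₂ y₂ b₂) (φ : X₁ ⟶ X₂) [IsIso φ] (ψ : Y₁ ⟶ Y₂)
    (hφ : ∀ i, g₁ i ≫ φ = g₂ i) (hψ : y₁ ≫ ψ = φ ≫ y₂) (hψ' : ∀ i, b₁ i ≫ ψ = b₂ i) :
    IsIso ψ := by
  obtain ⟨t, ht₁, ht₂⟩ := h₂.exists_desc (inv φ ≫ y₁) b₁ (fun i ↦ by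
    rw [h₁.w, ← hφ, Category.assoc, IsIso.hom_inv_id_assoc])
  refine ⟨t, h₁.hom_ext ?_ fun i ↦ ?_, h₂.hom_ext ?_ fun i ↦ ?_⟩
  · rw [reassoc_of% hψ, ht₁, IsIso.hom_inv_id_assoc, Category.comp_id]
  · rw [reassoc_of% (hψ' i), ht₂, Category.comp_id]
  · rw [reassoc_of% ht₁, hψ, IsIso.inv_hom_id_assoc, Category.comp_id]
  · rw [reassoc_of% (ht₂ i), hψ', Category.comp_id]

end IsCellAttachment

lemma isIso_app_of_isColimit {C : Type u} [Category.{v} C] {D : Type u'} [Category.{v'} D]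
    {J : Type w} [SmallCategory J] {Ψ₁ Ψ₂ : C ⥤ D} (α : Ψ₁ ⟶ Ψ₂) {F : J ⥤ C} {c : Cocone F}
    (h₁ : IsColimit (Ψ₁.mapCocone c)) (h₂ : IsColimit (Ψ₂.mapCocone c))
    (hα : ∀ j, IsIso (α.app (F.obj j))) : IsIso (α.app c.pt) := by
  let e : F ⋙ Ψ₁ ≅ F ⋙ Ψ₂ := NatIso.ofComponents (fun j ↦ asIso (α.app (F.obj j)))
    (fun φ ↦ α.naturality (F.map φ))
  have : α.app c.pt = (IsColimit.coconePointsIsoOfNatIso h₁ h₂ e).hom := by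
    refine h₁.hom_ext fun j ↦ ?_
    rw [IsColimit.comp_coconePointsIsoOfNatIso_hom]
    exact α.naturality (c.ι.app j)
  rw [this]
  infer_instance

/-! ### Left adjoints commute with fixed points of cofibrant objects -/

section

variable {G : Type v} [Group G] {C : Type u₁} [Category.{v} C] [HasColimits C]
  {D : Type u₂} [Category.{v} D] [HasColimits D]

/-- The canonical map `S ⊗ F A ⟶ F (S ⊗ A)`. -/
def tensorComparison (F : C ⥤ D) (S : Type v) [MulAction G S] (A : C) :
    tensor (G := G) S (F.obj A) ⟶ (mapGObj G F).obj (tensor S A) where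
  app _ := tensorDesc fun s ↦ F.map (tensorι A s)
  naturality _ _ (g : G) := tensorι_hom_ext fun s ↦ by
    refine ((reassoc_of% (tensorι_map (F.obj A) g s)) _).trans ?_
    rw [tensorι_tensorDesc, reassoc_of% tensorι_tensorDesc]
    exact (congrArg F.map (tensorι_map A g s)).symm.trans (F.map_comp _ _)

lemma tensorι_tensorComparison (F : C ⥤ D) {S : Type v} [MulAction G S] (A : C) (s : S) :
    tensorι (F.obj A) s ≫ (tensorComparison F S A).app (SingleObj.star G) =
      F.map (tensorι A s) :=
  tensorι_tensorDesc _ _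

lemma tensorComparison_naturality (F : C ⥤ D) (S : Type v) [MulAction G S] {A B : C}
    (f : A ⟶ B) : tensorComparison (G := G) F S A ≫ (mapGObj G F).map (tensorMap S f) =
      tensorMap S (F.map f) ≫ tensorComparison F S B :=
  tensor_hom_ext fun s ↦ by
    rw [NatTrans.comp_app, NatTrans.comp_app, reassoc_of% tensorι_tensorComparison,
      reassoc_of% tensorι_tensorMap, tensorι_tensorComparison]
    exact (F.map_comp _ _).symm.trans
      ((congrArg F.map (tensorι_tensorMap f s)).trans (F.map_comp _ _))

instance isIso_tensorComparison (F : C ⥤ D) [PreservesColimitsOfSize.{v, v} F] (S : Type v)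
    [MulAction G S] (A : C) : IsIso (tensorComparison (G := G) F S A) := by
  have (j : SingleObj G) : IsIso ((tensorComparison (G := G) F S A).app j) := by
    change IsIso (sigmaComparison F fun _ : S ↦ A)
    infer_instance
  exact NatIso.isIso_of_isIso_app _

variable [HasLimits C] [HasLimits D]

lemma fixedSummand_comparison (F : C ⥤ D) (H : Subgroup G) (S : Type v) [MulAction G S] (A : C)
    (s : MulAction.fixedPoints H S) :
    F.map (fixedSummand H S A s) ≫ (fixedPointsComparison F H).app (tensor S A) =
      fixedSummand H S (F.obj A) s ≫
        (fixedPointFunctor D H).map (tensorComparison F S A) :=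
  fixedPoints_hom_ext _ _ <| by
    rw [Category.assoc, Category.assoc, fixedPointsComparison_app_ι, fixedPointFunctor_map_ι,
      reassoc_of% fixedSummand_ι, tensorι_tensorComparison, ← F.map_comp, fixedSummand_ι]

/-- The comparison map matches the attaching and characteristic maps of the cells on both sides, as
`IsCellAttachment.isIso` requires. -/
lemma map_fixedSummand_comparison (F : C ⥤ D) (H : Subgroup G) {S : Type v} [MulAction G S]
    {A : C} {X : GObj G C} (a : tensor S A ⟶ X) (s : MulAction.fixedPoints H S) :
    F.map (fixedSummand H S A s ≫ (fixedPointFunctor C H).map a) ≫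
        (fixedPointsComparison F H).app X =
      fixedSummand H S (F.obj A) s ≫ (fixedPointFunctor D H).map
        (tensorComparison F S A ≫ (mapGObj G F).map a) := by
  rw [F.map_comp, Category.assoc, Functor.map_comp, ← reassoc_of% fixedSummand_comparison]
  exact congrArg _ ((fixedPointsComparison F H).naturality a)

/-- The fixed points of an initial object are initial. -/
def isInitialFixedPoints [ModelCategory C] {H : Subgroup G} (hC : IsCellular C H) {X : GObj G C}
    (hX : IsInitial X) : IsInitial ((fixedPointFunctor C H).obj X) := by
  -- An initial object can be taken of the form `G/H ⊗ ⊥_ C`, whose fixed points are a coproduct of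
  -- copies of `⊥_ C` by the third cellularity axiom.
  have h : IsInitial (tensor (G := G) (G ⧸ H) (⊥_ C)) :=
    IsInitial.ofUniqueHom (fun Z ↦ (tensorHomEquiv H _ Z).symm (initial.to _))
      fun Z φ ↦ (tensorHomEquiv H _ Z).injective (Subsingleton.elim _ _)
  have := hC.isIso_tensorFixedPoints H (⊥_ C)
  have hc := isColimitFixedSummand H (G ⧸ H) (⊥_ C)
  have h' : IsInitial ((fixedPointFunctor C H).obj (tensor (G := G) (G ⧸ H) (⊥_ C))) :=
    IsInitial.ofUniqueHom (fun Z ↦ Cofan.IsColimit.desc hc fun _ ↦ initial.to Z)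
      fun Z φ ↦ Cofan.IsColimit.hom_ext hc _ _ fun _ ↦ Subsingleton.elim _ _
  exact h'.ofIso ((fixedPointFunctor C H).mapIso (h.uniqueUpToIso hX))

variable [ModelCategory C] [ModelCategory D] {L : C ⥤ D} {R : D ⥤ C} {adj : L ⊣ R}

/-- Attaching cells preserves the objects on which the comparison map is an isomorphism. -/
lemma isIso_fixedPointsComparison_of_isCellAttachment {H : Subgroup G} (hC : IsCellular C H)
    (hD : IsCellular D H) (h : IsQuillenAdjunction adj) {ι : Type v} {K : ι → Subgroup G}
    {A B : ι → C} {f : ∀ i, A i ⟶ B i} (hf : ∀ i, cofibrations C (f i)) {X Y : GObj G C}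
    {g : ∀ i, tensor (G := G) (G ⧸ K i) (A i) ⟶ X} {y : X ⟶ Y}
    {b : ∀ i, tensor (G := G) (G ⧸ K i) (B i) ⟶ Y}
    (hy : IsCellAttachment (fun i ↦ tensorMap (G := G) (G ⧸ K i) (f i)) g y b)
    [IsIso ((fixedPointsComparison L H).app X)] :
    IsIso ((fixedPointsComparison L H).app Y) := by
  have : PreservesColimitsOfSize.{v, v} L := adj.leftAdjoint_preservesColimits
  -- Taking fixed points before or after applying `L` attaches the same cells `L.map (f i)`, indexed
  -- by the fixed points of the orbits `G/K i`.
  have h₁ := (hy.fixedPoints hC hf).map_of_adjunction adj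
  have h₂ := ((hy.map_of_adjunction (adj.whiskerRight (SingleObj G))).of_iso
    (f' := fun i ↦ tensorMap (G := G) (G ⧸ K i) (L.map (f i)))
    (fun i ↦ asIso (tensorComparison (G := G) L (G ⧸ K i) (A i)))
    (fun i ↦ asIso (tensorComparison (G := G) L (G ⧸ K i) (B i)))
    (fun i ↦ tensorComparison_naturality L (G ⧸ K i) (f i))).fixedPoints hD
      (fun i ↦ h.cofibrations_map _ (hf i))
  exact h₁.isIso h₂ ((fixedPointsComparison L H).app X) _
    (fun x ↦ map_fixedSummand_comparison L H (g x.1) x.2)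
    ((fixedPointsComparison L H).naturality y)
    (fun x ↦ map_fixedSummand_comparison L H (b x.1) x.2)

/-- The comparison map is an isomorphism on the target of a relative cell complex if it is an
isomorphism on the source. -/
lemma isIso_fixedPointsComparison_of_relativeCellComplex {H : Subgroup G} (hC : IsCellular C H)
    (hD : IsCellular D H) (h : IsQuillenAdjunction adj) {M : MorphismProperty C}
    (hM : M ≤ cofibrations C) {J : Type v} [LinearOrder J] [OrderBot J] [SuccOrder J]
    [WellFoundedLT J] {X Y : GObj G C} {f : X ⟶ Y}
    (c : RelativeCellComplex.{v} (fun _ : J ↦ (orbitCells G M).homFamily) f)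
    [IsIso ((fixedPointsComparison L H).app X)] :
    IsIso ((fixedPointsComparison L H).app Y) := by
  have : PreservesColimitsOfSize.{v, v} L := adj.leftAdjoint_preservesColimits
  have : PreservesColimitsOfSize.{v, v} (mapGObj G L) :=
    (adj.whiskerRight (SingleObj G)).leftAdjoint_preservesColimits
  -- `L` preserves cofibrations, so the directed axiom in `D` applies to the image of the complex;
  -- source and target of the comparison then both preserve the colimit.
  have hcolim {P : Type v} [LinearOrder P] [Nonempty P] (F : P ⥤ J) {d : Cocone (F ⋙ c.F)}
      (hd : IsColimit d) (hF : ∀ p, IsIso ((fixedPointsComparison L H).app (c.F.obj (F.obj p)))) :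
      IsIso ((fixedPointsComparison L H).app d.pt) := by
    have := hC.preservesColimit_relativeCellComplex hM c F
    have : PreservesColimit ((F ⋙ c.F) ⋙ mapGObj G L) (fixedPointFunctor D H) :=
      hD.preserves_directed P _ fun _ _ φ ↦ h.cofibrations_map _
        (underlyingCofibrations_relativeCellComplex_map hM c (F.map φ))
    exact isIso_app_of_isColimit (F := F ⋙ c.F) _
      (isColimitOfPreserves (fixedPointFunctor C H ⋙ L) hd)
      (isColimitOfPreserves (mapGObj G L ⋙ fixedPointFunctor D H) hd) hF
  have hF (j : J) : IsIso ((fixedPointsComparison L H).app (c.F.obj j)) := by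
    induction j using SuccOrder.limitRecOn with
    | isMin j hj =>
      obtain rfl := hj.eq_bot
      exact (NatTrans.isIso_app_iff_of_iso (fixedPointsComparison L H) c.isoBot).2 inferInstance
    | succ j hj hj' =>
      obtain ⟨ι, K, m, g, b, hb⟩ :=
        exists_isCellAttachment_of_attachCells_orbitCells (c.attachCells j hj)
      exact isIso_fixedPointsComparison_of_isCellAttachment hC hD h (fun i ↦ hM _ (m i).2) hb
    | isSuccLimit j hj hj' =>
      have : Nonempty (Set.Iio j) := ⟨⟨⊥, Order.IsSuccLimit.bot_lt hj⟩⟩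
      exact hcolim (Set.principalSegIio j).monotone.functor
        (c.F.isColimitOfIsWellOrderContinuous j hj) fun p ↦ hj' p.1 p.2
  exact hcolim (𝟭 J) (d := Cocone.mk Y c.incl) c.isColimit hF

/-- For cofibrant `X`, the canonical map `L (X^H) ⟶ (L X)^H` is an isomorphism. -/
theorem isIso_fixedPointsComparison_of_isCofibrant [IsCofibrantlyGenerated C]
    (hC : ∀ H : Subgroup G, IsCellular C H) (hD : ∀ H : Subgroup G, IsCellular D H)
    (h : IsQuillenAdjunction adj) {mC : ModelCategory (GObj G C)}
    (hmC : IsFixedPointModelStructure mC) (X : GObj G C) [IsCofibrant X] (H : Subgroup G) :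
    IsIso ((fixedPointsComparison L H).app X) := by
  obtain ⟨I, J, _, _, hI, hJ⟩ := IsCofibrantlyGenerated.exists_generators (C := C)
  have hI' := le_cofibrations_of_trivialFibrations_eq_rlp hI
  have := hasSmallObjectArgument_orbitCells hC hI'
  obtain ⟨κ, _, _, _⟩ :=
    MorphismProperty.HasSmallObjectArgument.exists_cardinal (I := orbitCells G I)
  have hX : cofibrations (GObj G C) (initial.to X) := mem_cofibrations _
  rw [hmC.cofibrations_eq hI] at hX
  have : PreservesColimitsOfSize.{v, v} (mapGObj G L) :=
    (adj.whiskerRight (SingleObj G)).leftAdjoint_preservesColimits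
  have : PreservesColimitsOfSize.{v, v} L := adj.leftAdjoint_preservesColimits
  have h₀ : IsIso ((fixedPointsComparison L H).app (⊥_ (GObj G C))) := by
    have i₁ : IsInitial (L.obj ((fixedPointFunctor C H).obj (⊥_ (GObj G C)))) :=
      IsInitial.isInitialObj L _ (isInitialFixedPoints (hC H) initialIsInitial)
    have i₂ : IsInitial ((fixedPointFunctor D H).obj ((mapGObj G L).obj (⊥_ (GObj G C)))) :=
      isInitialFixedPoints (hD H) (IsInitial.isInitialObj (mapGObj G L) _ initialIsInitial)
    exact isIso_of_isInitial i₁ i₂ _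
  have h₁ := isIso_fixedPointsComparison_of_relativeCellComplex (hC H) (hD H) h hI'
    (SmallObject.relativeCellComplexιObj (orbitCells G I) κ (initial.to X))
  have sq : CommSq (SmallObject.ιObj (orbitCells G I) κ (initial.to X)) (initial.to X)
    (SmallObject.πObj (orbitCells G I) κ (initial.to X)) (𝟙 _) := ⟨by simp⟩
  have := hX _ (SmallObject.rlp_πObj (orbitCells G I) κ (initial.to X))
  -- A cofibrant `X` is a retract of a complex of orbit cells, and isomorphisms are closed under
  -- retracts.
  let r : Retract X (SmallObject.obj (orbitCells G I) κ (initial.to X)) :=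
    { i := sq.lift
      r := SmallObject.πObj (orbitCells G I) κ (initial.to X) }
  exact (MorphismProperty.isomorphisms D).of_retract
    (NatTrans.retractArrowApp (fixedPointsComparison L H) r) h₁

lemma isCofibrant_fixedPoints [IsCofibrantlyGenerated C]
    (hC : ∀ H : Subgroup G, IsCellular C H) {mC : ModelCategory (GObj G C)}
    (hmC : IsFixedPointModelStructure mC) (X : GObj G C) [IsCofibrant X] (H : Subgroup G) :
    IsCofibrant ((fixedPointFunctor C H).obj X) := by
  obtain ⟨I, J, _, _, hI, hJ⟩ := IsCofibrantlyGenerated.exists_generators (C := C)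
  have hX : cofibrations (GObj G C) (initial.to X) := mem_cofibrations _
  rw [hmC.cofibrations_eq hI] at hX
  have := fixedPoints_map_llp_rlp hC (le_cofibrations_of_trivialFibrations_eq_rlp hI) _ hX H
  rw [← hI, MorphismProperty.llp_eq_of_wfs (cofibrations C)] at this
  exact (isCofibrant_iff_of_isInitial _ (isInitialFixedPoints (hC H) initialIsInitial)).2 ⟨this⟩

lemma isFibrant_fixedPoints {mC : ModelCategory (GObj G C)}
    (hmC : IsFixedPointModelStructure mC) (X : GObj G C) [IsFibrant X] (H : Subgroup G) :
    IsFibrant ((fixedPointFunctor C H).obj X) := by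
  have hX : fibrations (GObj G C) (terminal.from X) := mem_fibrations _
  have : PreservesLimitsOfSize.{v, v} (fixedPointFunctor C H) :=
    (tensorAdjunction C H).rightAdjoint_preservesLimits
  exact (isFibrant_iff_of_isTerminal _ (IsTerminal.isTerminalObj (fixedPointFunctor C H) _
    terminalIsTerminal)).2 ⟨(hmC.fibrations_iff _).1 hX H⟩

/-- A Quillen equivalence induces a Quillen equivalence between fixed point model structures. -/
theorem IsQuillenEquivalence.whiskerRight [IsCofibrantlyGenerated C]
    (hC : ∀ H : Subgroup G, IsCellular C H) (hD : ∀ H : Subgroup G, IsCellular D H)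
    (h : IsQuillenEquivalence adj) {mC : ModelCategory (GObj G C)} {mD : ModelCategory (GObj G D)}
    (hmC : IsFixedPointModelStructure mC) (hmD : IsFixedPointModelStructure mD) :
    IsQuillenEquivalence (adj.whiskerRight (SingleObj G)) where
  toIsQuillenAdjunction := h.toIsQuillenAdjunction.whiskerRight hmC hmD
  weakEquivalences_iff X Y hX hY f := by
    have (H : Subgroup G) : PreservesLimitsOfShape (SingleObj H) R :=
      adj.rightAdjoint_preservesLimits.preservesLimitsOfShape
    rw [hmC.weakEquivalences_iff, hmD.weakEquivalences_iff]
    refine forall_congr' fun H ↦ ?_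
    have := isIso_fixedPointsComparison_of_isCofibrant hC hD h.toIsQuillenAdjunction hmC X H
    -- The comparison map for `R` is cancelled on the right and that for `L` on the left; between
    -- them stands the equivalence for `X^H` and `Y^H`.
    rw [← homEquiv_fixedPointsComparison, (weakEquivalences C).cancel_right_of_respectsIso,
      ← h.weakEquivalences_iff _ _ (isCofibrant_fixedPoints hC hmC X H)
        (isFibrant_fixedPoints hmD Y H), (weakEquivalences D).cancel_left_of_respectsIso]

end

end

end FixedPointModel

/-- The claims about adjunctions are proved for arbitrary fixed point model structures, so they do
not depend on the construction used for existence. -/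
theorem mainTheorem3 {G : Type v} [Group G]
    {C : Type u₁} [Category.{v} C] [HasLimits C] [HasColimits C]
    [ModelCategory C] [FixedPointModel.IsCofibrantlyGenerated C]
    {D : Type u₂} [Category.{v} D] [HasLimits D] [HasColimits D]
    [ModelCategory D] [FixedPointModel.IsCofibrantlyGenerated D]
    (hC : ∀ H : Subgroup G, FixedPointModel.IsCellular C H)
    (hD : ∀ H : Subgroup G, FixedPointModel.IsCellular D H)
    {L : C ⥤ D} {R : D ⥤ C} (adj : L ⊣ R)
    (hadj : FixedPointModel.IsQuillenAdjunction adj) :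
    (∃ mC : ModelCategory (FixedPointModel.GObj G C),
      FixedPointModel.IsFixedPointModelStructure mC) ∧
    (∃ mD : ModelCategory (FixedPointModel.GObj G D),
      FixedPointModel.IsFixedPointModelStructure mD) ∧
    ∀ (mC : ModelCategory (FixedPointModel.GObj G C))
      (mD : ModelCategory (FixedPointModel.GObj G D)),
      FixedPointModel.IsFixedPointModelStructure mC →
      FixedPointModel.IsFixedPointModelStructure mD →
      FixedPointModel.IsQuillenAdjunction (adj.whiskerRight (SingleObj G)) ∧
      (FixedPointModel.IsQuillenEquivalence adj →
        FixedPointModel.IsQuillenEquivalence (adj.whiskerRight (SingleObj G))) :=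
  ⟨FixedPointModel.exists_isFixedPointModelStructure G C hC,
    FixedPointModel.exists_isFixedPointModelStructure G D hD, fun _ _ hmC hmD ↦
    ⟨hadj.whiskerRight hmC hmD, fun h ↦ h.whiskerRight hC hD hmC hmD⟩⟩
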